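/- For integers $n\ge 5$ and $1<s<n/2$ let $C_n(1,s)$ be the circulant graph with vertex set $\mathbb Z/n$ in which $i,j$ are adjacent if and only if $i-j\in\{\pm1,\pm s\}$. An (all-to-all) routing $R$ of a graph $G$ consists of one path of $G$ from $x$ to $y$ for every ordered pair $(x,y)$ of distinct vertices. A colouring of the paths of $R$ is edge-conflict-free if any two different paths with a common edge (traversed in any directions) have distinct colours, and arc-conflict-free if any two different paths that traverse a common edge in the same direction have distinct colours. Let $w(G)$ (respectively $\overrightarrow{w}(G)$) be the smallest number of colours in an edge-conflict-free (respectively arc-conflict-free) colouring of $R$, minimised over all routings $R$ of $G$. The routing and wavelength assignment problem asks for $w(G)$, and its oriented version for $\overrightarrow{w}(G)$. **Corollary.** There is a $4.85$-factor approximation algorithm for the routing and wavelength assignment problem, and one for its oriented version, on the graphs $C_n(1,s)$ with $n$ sufficiently large and $3\le s\le \frac{3\sqrt n}{2\sqrt2}-1$. That is, for each of the two problems there are an algorithm with input $(n,s)$, running in time polynomial in $n$, and an integer $N$ such that for all integers $n\ge N$ and $3\le s\le\frac{3\sqrt n}{2\sqrt 2}-1$ the algorithm outputs a routing of $C_n(1,s)$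 together with an edge-conflict-free (respectively arc-conflict-free) colouring of it that uses at most $4.85\,w(C_n(1,s))$ (respectively $4.85\,\overrightarrow{w}(C_n(1,s))$) colours. Here an algorithm is a program for a random access machine with unit-cost addition, subtraction, integer division, remainder, comparison and memory access on integers, and running time is its number of steps. -/

import Mathlib

/-! ## All-to-all routings and optical indices -/

/-- A connection request: an ordered pair of distinct nodes. -/
abbrev Request (V : Type*) := {p : V × V // p.1 ≠ p.2}

/-- An all-to-all routing of `G`: one path of `G` from `x` to `y` for every request `(x, y)`.
The paths for `(x, y)` and `(y, x)` need not be related. -/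
abbrev Routing {V : Type*} (G : SimpleGraph V) := ∀ p : Request V, G.Path p.1.1 p.1.2

/-- Any two different paths of the routing with a common edge, in whatever directions they
traverse it, have distinct colours. Different requests have different paths, so colouring the
paths is the same as colouring the requests. -/
def EdgeConflictFree {V K : Type*} {G : SimpleGraph V} (R : Routing G) (f : Request V → K) : Prop :=
  ∀ p p' : Request V, p ≠ p' →
    (∃ e : Sym2 V, e ∈ (R p).1.edges ∧ e ∈ (R p').1.edges) → f p ≠ f p'

/-- Any two different paths of the routing with a common arc (a common edge traversed in the
same direction) have distinct colours. -/
def ArcConflictFree {V K : Type*} {G : SimpleGraph V} (R : Routing G) (f : Request V → K) : Prop :=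
  ∀ p p' : Request V, p ≠ p' →
    (∃ a : G.Dart, a ∈ (R p).1.darts ∧ a ∈ (R p').1.darts) → f p ≠ f p'

/-- `w(G, R)`: the minimum number of colours of an edge-conflict-free colouring of `R`. -/
noncomputable def edgeColourNumber {V : Type*} {G : SimpleGraph V} (R : Routing G) : ℕ :=
  sInf {k : ℕ | ∃ f : Request V → Fin k, EdgeConflictFree R f}

/-- The same minimum over arc-conflict-free colourings of `R`. -/
noncomputable def arcColourNumber {V : Type*} {G : SimpleGraph V} (R : Routing G) : ℕ :=
  sInf {k : ℕ | ∃ f : Request V → Fin k, ArcConflictFree R f}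

/-- The undirected optical index `w(G)` of a finite connected graph. -/
noncomputable def opticalIndex {V : Type*} (G : SimpleGraph V) : ℕ :=
  sInf {k : ℕ | ∃ R : Routing G, k = edgeColourNumber R}

/-- The directed optical index of a finite connected graph. -/
noncomputable def directedOpticalIndex {V : Type*} (G : SimpleGraph V) : ℕ :=
  sInf {k : ℕ | ∃ R : Routing G, k = arcColourNumber R}

/-- The circulant graph `C_n(1, s)`: vertex set `ℤ/n`, connection set `{1, s, -1, -s}`. -/
def circ (n s : ℕ) : SimpleGraph (ZMod n) :=
  SimpleGraph.circulantGraph {(1 : ZMod n), (s : ZMod n), -1, -(s : ZMod n)}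

/-! ## A machine model with a step count

A random access machine with integer memory cells and structured control. There is no
multiplication, so that a computation of `t` steps only produces integers of bit length
linear in `t` (and in the bit length of the input): up to a polynomial, the number of steps
is Turing machine time. -/

/-- Integer expressions over the memory; `load a` is the content of the cell with address `a`. -/
inductive Expr where
  | const (z : ℤ)
  | load (a : Expr)
  | add (a b : Expr)
  | sub (a b : Expr)
  | div (a b : Expr)
  | mod (a b : Expr)

/-- The value of an expression. Division is integer division. -/
def Expr.eval (m : ℤ → ℤ) : Expr → ℤ
  | .const z => z
  | .load a => m (a.eval m)
  | .add a b => a.eval m + b.eval m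
  | .sub a b => a.eval m - b.eval m
  | .div a b => a.eval m / b.eval m
  | .mod a b => a.eval m % b.eval m

/-- The cost of evaluating an expression: one step for every operation and every constant. -/
def Expr.cost : Expr → ℕ
  | .const _ => 1
  | .load a => a.cost + 1
  | .add a b => a.cost + b.cost + 1
  | .sub a b => a.cost + b.cost + 1
  | .div a b => a.cost + b.cost + 1
  | .mod a b => a.cost + b.cost + 1

/-- Programs. -/
inductive Prog where
  /-- do nothing -/
  | skip
  /-- store the value of `e` in the cell with address `a` -/
  | store (a e : Expr)
  /-- append the value of `e` to the output -/
  | emit (e : Expr)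
  /-- run the first program, then the second -/
  | seq (P Q : Prog)
  /-- run the first program if `a < b`, else the second -/
  | ifLt (a b : Expr) (P Q : Prog)
  /-- evaluate `e` once, and run `P` that many times (not at all if the value is negative) -/
  | repeat (e : Expr) (P : Prog)

/-- A configuration: the memory, the output so far, and the number of steps made so far. -/
structure Config where
  mem : ℤ → ℤ
  out : List ℤ
  steps : ℕ

/-- Execution of a program from a given configuration. -/
def Prog.run : Prog → Config → Config
  | .skip => fun c => { c with steps := c.steps + 1 }
  | .store a e => fun c =>
      { c with
        mem := Function.update c.mem (a.eval c.mem) (e.eval c.mem)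
        steps := c.steps + a.cost + e.cost + 1 }
  | .emit e => fun c =>
      { c with
        out := c.out ++ [e.eval c.mem]
        steps := c.steps + e.cost + 1 }
  | .seq P Q => fun c => Q.run (P.run c)
  | .ifLt a b P Q => fun c =>
      let c' : Config := { c with steps := c.steps + a.cost + b.cost + 1 }
      if a.eval c.mem < b.eval c.mem then P.run c' else Q.run c'
  | .repeat e P => fun c =>
      (fun d : Config => P.run { d with steps := d.steps + 1 })^[(e.eval c.mem).toNat]
        { c with steps := c.steps + e.cost + 1 }

/-- The initial configuration on input `(n, s)`: `n` in cell `0`, `s` in cell `1`, and `0`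
everywhere else. -/
def initConfig (n s : ℕ) : Config where
  mem := fun a => if a = 0 then (n : ℤ) else if a = 1 then (s : ℤ) else 0
  out := []
  steps := 0

/-- The final configuration of the program on input `(n, s)`. -/
def Prog.exec (P : Prog) (n s : ℕ) : Config := P.run (initConfig n s)

/-! ## The output format -/

/-- The record of a request: the number of nodes of its path, the nodes of the path in order
(as integers in `[0, n)`), and the colour of the path. -/
def encodeRequest {n : ℕ} {G : SimpleGraph (ZMod n)} (R : Routing G) (f : Request (ZMod n) → ℤ)
    (p : Request (ZMod n)) : List ℤ :=
  ((R p).1.support.length : ℤ) :: ((R p).1.support.map fun v => ((v.val : ℕ) : ℤ)) ++ [f p]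

/-- The list of the records of all requests `(x, y)`, in lexicographic order of `(x, y)` with
`0 ≤ x, y < n`. -/
def encodeRouting {n : ℕ} {G : SimpleGraph (ZMod n)} (R : Routing G) (f : Request (ZMod n) → ℤ) :
    List ℤ :=
  (List.range n).flatMap fun x => (List.range n).flatMap fun y =>
    if h : (x : ZMod n) ≠ (y : ZMod n) then encodeRequest R f ⟨((x : ZMod n), (y : ZMod n)), h⟩
    else []

/-! ## Reasoning about programs -/

/-! Lower bound. Weigh each arc by the cyclic distance of its ends. A path weighs at least the
cyclic distance of its ends, and these distances sum to n⌊n²/4⌋ over all requests, while all arcs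
together weigh at most 2n(s+1). With k colours an arc lies on at most k paths, so ⌊n²/4⌋ ≤ 2(s+1)k;
in the undirected problem an arc and its reverse together lie on at most k paths, and the factor 2
disappears (`le_of_arcConflictFree`, `le_of_edgeConflictFree`).

Upper bound. A request of cyclic length d walks B steps of size s, B being the integer nearest to
d/s, then at most s/2 steps of size 1. Its colour is a pair: a tag (the difference y - x, or only d
in the oriented problem) and the block of width w = ⌈5(s+1)/6⌉ that contains mx mod n. If two paths
with equal tags share an arc, their sources differ by ks with |k| < B, or by k with |k| less than
the number of short steps. The multiplier m = ⌈(n+w)/s⌉ makes sm - n lie between w and 2s, and m ≥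
w; hence for k ≠ 0 the number m(x - x') stays at distance at least w from every multiple of n, and
the blocks differ (`sourceColour_ne`, `eq_of_common_arc`). That m ≥ w needs (s-1)w ≤ n, which is
what the range of s provides.

There are at most n/w + 1 blocks, and n or n/2 + 1 tags. The ratio to the lower bound tends to 4·6/5
= 4.8, and large n absorbs the lower-order terms (`ratio_le`). The program writes this routing down
in O(n³) steps, replacing products by repeated addition. -/

/-- From memory `m`, the program `P` reaches memory `m'`, appends `o` to the output and makes at
most `t` steps. -/
def Prog.Does (P : Prog) (m m' : ℤ → ℤ) (o : List ℤ) (t : ℕ) : Prop :=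
  ∃ t' ≤ t, ∀ out st, P.run ⟨m, out, st⟩ = ⟨m', out ++ o, st + t'⟩

namespace Prog.Does

theorem skip (m : ℤ → ℤ) : Prog.skip.Does m m [] 1 :=
  ⟨1, le_rfl, fun out st => by simp [Prog.run]⟩

theorem store (m : ℤ → ℤ) (a e : Expr) :
    (Prog.store a e).Does m (Function.update m (a.eval m) (e.eval m)) [] (a.cost + e.cost + 1) :=
  ⟨a.cost + e.cost + 1, le_rfl, fun out st => by simp [Prog.run, add_assoc]⟩

theorem emit (m : ℤ → ℤ) (e : Expr) : (Prog.emit e).Does m m [e.eval m] (e.cost + 1) :=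
  ⟨e.cost + 1, le_rfl, fun out st => by simp [Prog.run, add_assoc]⟩

theorem mono {P : Prog} {m m' : ℤ → ℤ} {o : List ℤ} {t t' : ℕ} (h : P.Does m m' o t)
    (ht : t ≤ t') : P.Does m m' o t' :=
  let ⟨r, hr, H⟩ := h
  ⟨r, hr.trans ht, H⟩

theorem congr {P : Prog} {m m₁ m₂ : ℤ → ℤ} {o o' : List ℤ} {t t' : ℕ} (h : P.Does m m₁ o t)
    (hm : m₁ = m₂) (ho : o = o') (ht : t ≤ t') : P.Does m m₂ o' t' := by
  subst hm ho
  exact h.mono ht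

theorem seq {P Q : Prog} {m m' m'' : ℤ → ℤ} {o o' : List ℤ} {t t' : ℕ} (hP : P.Does m m' o t)
    (hQ : Q.Does m' m'' o' t') : (Prog.seq P Q).Does m m'' (o ++ o') (t + t') := by
  obtain ⟨r, hr, H⟩ := hP
  obtain ⟨r', hr', H'⟩ := hQ
  exact ⟨r + r', by omega, fun out st => by simp [Prog.run, H, H', add_assoc]⟩

theorem ifLt_pos {P Q : Prog} {a b : Expr} {m m' : ℤ → ℤ} {o : List ℤ} {t : ℕ}
    (h : a.eval m < b.eval m) (hP : P.Does m m' o t) :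
    (Prog.ifLt a b P Q).Does m m' o (a.cost + b.cost + 1 + t) := by
  obtain ⟨r, hr, H⟩ := hP
  exact ⟨a.cost + b.cost + 1 + r, by omega, fun out st => by simp [Prog.run, h, H, add_assoc]⟩

theorem ifLt_neg {P Q : Prog} {a b : Expr} {m m' : ℤ → ℤ} {o : List ℤ} {t : ℕ}
    (h : ¬ a.eval m < b.eval m) (hQ : Q.Does m m' o t) :
    (Prog.ifLt a b P Q).Does m m' o (a.cost + b.cost + 1 + t) := by
  obtain ⟨r, hr, H⟩ := hQ
  exact ⟨a.cost + b.cost + 1 + r, by omega, fun out st => by simp [Prog.run, h, H, add_assoc]⟩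

theorem ifLt_store (m : ℤ → ℤ) (a b c e e' : Expr) :
    (Prog.ifLt a b (.store c e) (.store c e')).Does m
      (Function.update m (c.eval m) (if a.eval m < b.eval m then e.eval m else e'.eval m)) []
      (a.cost + b.cost + c.cost + e.cost + e'.cost + 2) := by
  by_cases h : a.eval m < b.eval m
  · rw [if_pos h]
    exact (ifLt_pos h (store m c e)).mono (by omega)
  · rw [if_neg h]
    exact (ifLt_neg h (store m c e')).mono (by omega)

/-- The family `M` of memories is the loop invariant. The bound has `t + 1` because the machine
charges one step per pass. -/
theorem iterate {P : Prog} {e : Expr} {M : ℕ → ℤ → ℤ} {O : ℕ → List ℤ} {t N : ℕ}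
    (hN : (e.eval (M 0)).toNat = N) (h : ∀ i < N, P.Does (M i) (M (i + 1)) (O i) t) :
    (Prog.repeat e P).Does (M 0) (M N) ((List.range N).flatMap O) (e.cost + 1 + N * (t + 1)) := by
  have key : ∀ k ≤ N, ∃ r ≤ k * (t + 1), ∀ out st,
      (fun d : Config => P.run { d with steps := d.steps + 1 })^[k] ⟨M 0, out, st⟩ =
        ⟨M k, out ++ (List.range k).flatMap O, st + r⟩ := by
    intro k
    induction k with
    | zero => exact fun _ => ⟨0, by simp, fun out st => by simp⟩
    | succ k ih =>
      intro hk
      obtain ⟨r, hr, H⟩ := ih (by omega)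
      obtain ⟨r', hr', H'⟩ := h k (by omega)
      refine ⟨r + 1 + r', by rw [Nat.succ_mul]; omega, fun out st => ?_⟩
      rw [Function.iterate_succ_apply', H]
      simp only [H', List.range_succ, List.flatMap_append, List.flatMap_singleton,
        List.append_assoc, add_assoc]
  obtain ⟨r, hr, H⟩ := key N le_rfl
  refine ⟨e.cost + 1 + r, by omega, fun out st => ?_⟩
  simp only [Prog.run, hN, H, add_assoc]

end Prog.Does

/-- The memory with the given contents in the cells `0, 1, …`, and `0` everywhere else. -/
def memOf (l : List ℤ) : ℤ → ℤ := fun a => if a < 0 then 0 else l.getD a.toNat 0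

theorem update_memOf (l : List ℤ) (i : ℕ) (hi : i < l.length) (z : ℤ) :
    Function.update (memOf l) (i : ℤ) z = memOf (l.set i z) := by
  funext a
  by_cases ha : a = i
  · subst ha
    simp [memOf, hi]
  · rw [Function.update_of_ne ha]
    by_cases h0 : a < 0
    · simp [memOf, h0]
    · have : i ≠ a.toNat := by omega
      simp [memOf, h0, List.getElem?_set_ne this]

/-- The content of cell `i`. -/
abbrev Expr.cell (i : ℕ) : Expr := .load (.const i)

/-- Assignment to cell `i`. -/
abbrev Prog.assign (i : ℕ) (e : Expr) : Prog := .store (.const i) e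

theorem Prog.Does.assign {l : List ℤ} {i : ℕ} {e : Expr} {z : ℤ} {t : ℕ} (hi : i < l.length)
    (hz : e.eval (memOf l) = z) (ht : e.cost + 2 ≤ t) :
    (Prog.assign i e).Does (memOf l) (memOf (l.set i z)) [] t := by
  have h := Prog.Does.store (memOf l) (.const i) e
  rw [hz] at h
  simp only [Expr.eval, update_memOf l i hi, Expr.cost] at h
  exact h.mono (by omega)

theorem Prog.Does.assignIf {l : List ℤ} {i : ℕ} {a b e e' : Expr} {z : ℤ} {t : ℕ}
    (hi : i < l.length)
    (hz : (if a.eval (memOf l) < b.eval (memOf l) then e.eval (memOf l) else e'.eval (memOf l)) = z)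
    (ht : a.cost + b.cost + e.cost + e'.cost + 3 ≤ t) :
    (Prog.ifLt a b (.assign i e) (.assign i e')).Does (memOf l) (memOf (l.set i z)) [] t := by
  have h := Prog.Does.ifLt_store (memOf l) a b (.const i) e e'
  rw [hz] at h
  simp only [Expr.eval, update_memOf l i hi, Expr.cost] at h
  exact h.mono (by omega)

theorem Prog.Does.emit_eq {m : ℤ → ℤ} {e : Expr} {z : ℤ} {t : ℕ} (hz : e.eval m = z)
    (ht : e.cost + 1 ≤ t) : (Prog.emit e).Does m m [z] t := by
  subst hz
  exact (Prog.Does.emit m e).mono ht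

/-- Run the programs of a list one after the other. -/
def Prog.block : List Prog → Prog
  | [] => .skip
  | P :: L => .seq P (block L)

theorem Prog.Does.block_nil (m : ℤ → ℤ) : (Prog.block []).Does m m [] 1 := Prog.Does.skip m

theorem Prog.Does.block_cons {P : Prog} {L : List Prog} {m m' m'' : ℤ → ℤ} {o o' : List ℤ}
    {t t' : ℕ} (hP : P.Does m m' o t) (hL : (Prog.block L).Does m' m'' o' t') :
    (Prog.block (P :: L)).Does m m'' (o ++ o') (t + t') := hP.seq hL

theorem initConfig_eq (n s : ℕ) : initConfig n s =
    ⟨memOf [(n : ℤ), s, 0, 0, 0, 0, 0, 0, 0, 0, 0, 0, 0, 0, 0], [], 0⟩ := by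
  unfold initConfig memOf
  congr 1
  funext a
  by_cases h0 : a < 0
  · rw [if_neg (by omega), if_neg (by omega), if_pos h0]
  · obtain ⟨k, rfl⟩ := Int.eq_ofNat_of_zero_le (not_lt.mp h0)
    match k with
    | 0 => simp
    | 1 => simp
    | k + 2 =>
      rw [if_neg (by omega), if_neg (by omega), if_neg h0]
      simp only [Int.toNat_natCast, List.getD_cons_succ]
      -- Cells 2 to 14 are the thirteen explicit zeros.
      iterate 13 (rcases k with _ | k; · simp)
      simp

/-! ## The quantities that the algorithm computes -/

/-- The length of a request with difference `e`, `0 ≤ e < n`, on the cycle of length `n`. -/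
def cycDist (n e : ℤ) : ℤ := if n < e + e then n - e else e

/-- The direction of a request with difference `e`, `0 ≤ e < n`, on the cycle of length `n`. -/
def cycSign (n e : ℤ) : ℤ := if n < e + e then -1 else 1

/-- The multiple of `s` next to `d`, divided by `s`. -/
def longSteps (s d : ℤ) : ℤ := (d + d + s - 1) / (s + s)

/-- The signed distance from `longSteps s d * s` to `d`. -/
def shortOffset (s d : ℤ) : ℤ := ((d + d + s - 1) % (s + s) - (s - 1)) / 2

/-- The direction of the short steps. -/
def shortSign (s d : ℤ) : ℤ := if shortOffset s d < 0 then -1 else 1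

/-- The number of short steps. -/
def shortSteps (s d : ℤ) : ℤ := if shortOffset s d < 0 then - shortOffset s d else shortOffset s d

/-- The width of a colour class. -/
def width (s : ℤ) : ℤ := s + 1 - (s + 1) / 6

/-- The multiplier of the colouring. -/
def multiplier (n s : ℤ) : ℤ := (n + width s + s - 1) / s

/-- The number by which the differences are told apart: the difference itself, or its length. -/
def diffTag (c : Bool) (n e : ℤ) : ℤ := if c then e else cycDist n e

/-! ## The program -/

section Program

open Expr Prog

/-- Walk `count` steps of size `step` from the node in cell `13`, and emit the nodes. -/
def walkProg (count step : ℕ) : Prog :=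
  .repeat (cell count) (block [
    assign 13 (.mod (.add (cell 13) (cell step)) (cell 0)),
    emit (cell 13)])

/-- Emit the record of the request from cell `4` to cell `5`, with difference in cell `7`. -/
def recordProg (c : Bool) : Prog := block [
  .ifLt (cell 0) (.add (cell 7) (cell 7))
    (assign 8 (.sub (cell 0) (cell 7))) (assign 8 (cell 7)),
  .ifLt (cell 0) (.add (cell 7) (cell 7))
    (assign 9 (.sub (.const 0) (cell 1))) (assign 9 (cell 1)),
  assign 11 (.div (.sub (.add (.add (cell 8) (cell 8)) (cell 1)) (.const 1))
    (.add (cell 1) (cell 1))),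
  assign 12 (.div (.sub (.mod (.sub (.add (.add (cell 8) (cell 8)) (cell 1)) (.const 1))
    (.add (cell 1) (cell 1))) (.sub (cell 1) (.const 1))) (.const 2)),
  .ifLt (cell 0) (.add (cell 7) (cell 7)) (assign 10 (.const (-1))) (assign 10 (.const 1)),
  .ifLt (cell 12) (.const 0) (assign 10 (.sub (.const 0) (cell 10))) (assign 10 (cell 10)),
  .ifLt (cell 12) (.const 0) (assign 12 (.sub (.const 0) (cell 12))) (assign 12 (cell 12)),
  emit (.add (.add (cell 11) (cell 12)) (.const 1)),
  emit (cell 4),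
  assign 13 (cell 4),
  walkProg 11 9,
  walkProg 12 10,
  assign 14 (.div (cell 6) (cell 2)),
  .repeat (cell (if c then 7 else 8)) (assign 14 (.add (cell 14) (cell 0))),
  emit (cell 14),
  assign 8 (.const 0), assign 9 (.const 0), assign 10 (.const 0), assign 11 (.const 0),
  assign 12 (.const 0), assign 13 (.const 0), assign 14 (.const 0)]

/-- Emit the record of the request from cell `4` to cell `5`, if these are distinct. -/
def requestProg (c : Bool) : Prog := block [
  assign 7 (.mod (.sub (cell 5) (cell 4)) (cell 0)),
  .ifLt (.const 0) (cell 7) (recordProg c) .skip,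
  assign 7 (.const 0),
  assign 5 (.add (cell 5) (.const 1))]

/-- Emit the records of all requests from cell `4`. -/
def sourceProg (c : Bool) : Prog := block [
  assign 5 (.const 0),
  .repeat (cell 0) (requestProg c),
  assign 5 (.const 0),
  assign 6 (.mod (.add (cell 6) (cell 3)) (cell 0)),
  assign 4 (.add (cell 4) (.const 1))]

/-- The routing and wavelength assignment algorithm. -/
def routingProg (c : Bool) : Prog := block [
  assign 2 (.sub (.add (cell 1) (.const 1)) (.div (.add (cell 1) (.const 1)) (.const 6))),
  assign 3 (.div (.sub (.add (.add (cell 0) (cell 2)) (cell 1)) (.const 1)) (cell 1)),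
  .repeat (cell 0) (sourceProg c)]

end Program

/-- The record of the request from `x` to `y` with source value `l`. -/
def recordOut (c : Bool) (n s x l e : ℤ) : List ℤ :=
  let d := cycDist n e
  (longSteps s d + shortSteps s d + 1) :: x ::
    ((List.range (longSteps s d).toNat).map (fun i : ℕ => (x + (i + 1) * (cycSign n e * s)) % n) ++
    (List.range (shortSteps s d).toNat).map (fun i : ℕ =>
      (x + longSteps s d * (cycSign n e * s) + (i + 1) * (cycSign n e * shortSign s d)) % n) ++
    [l / width s + n * diffTag c n e])

/-! ### Correctness and running time of the program -/

section Verification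

open Expr Prog

variable {n s w m x y l e d u v b a z q : ℤ}

/-- Invariant: cell 13 holds `(z + i * u) % n`. The hypothesis `hz` starts it at `i = 0`, and `hN`
keeps the time linear in `n`. -/
theorem walkProg_long_does (hz : z % n = z) (hb : 0 ≤ b) (hN : b ≤ n) :
    (walkProg 11 9).Does (memOf [n, s, w, m, x, y, l, e, d, u, v, b, a, z, q])
      (memOf [n, s, w, m, x, y, l, e, d, u, v, b, a, (z + b * u) % n, q])
      ((List.range b.toNat).map fun i : ℕ => (z + (i + 1) * u) % n) (3 + n.toNat * 20) := by
  have h := Prog.Does.iterate (e := cell 11) (N := b.toNat) (t := 19)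
    (P := block [assign 13 (.mod (.add (cell 13) (cell 9)) (cell 0)), emit (cell 13)])
    (M := fun i : ℕ => memOf [n, s, w, m, x, y, l, e, d, u, v, b, a, (z + i * u) % n, q])
    (O := fun i : ℕ => [(z + (i + 1) * u) % n]) (by simp [Expr.eval, memOf]) (by
      intro i _
      have H := Prog.Does.block_cons
          (P := assign 13 (.mod (.add (cell 13) (cell 9)) (cell 0)))
          (Prog.Does.assign (l := [n, s, w, m, x, y, l, e, d, u, v, b, a, (z + i * u) % n, q])
            (z := (z + (i + 1) * u) % n) (t := 10) (by simp)
            (by simp [Expr.eval, memOf, add_assoc, add_mul]) (by simp [Expr.cost])) <|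
        Prog.Does.block_cons (P := emit (cell 13))
          (Prog.Does.emit_eq (z := (z + (i + 1) * u) % n) (t := 5) (by simp [Expr.eval, memOf])
            (by simp [Expr.cost])) <|
        Prog.Does.block_nil _
      exact H.congr (by simp) (by simp) (by simp))
  simp only [Nat.cast_zero, zero_mul, add_zero, hz, Int.toNat_of_nonneg hb,
    ← List.map_eq_flatMap] at h
  refine Prog.Does.mono h ?_
  have : b.toNat ≤ n.toNat := by omega
  simp only [Expr.cost]
  omega

theorem walkProg_short_does (hz : z % n = z) (ha : 0 ≤ a) (hN : a ≤ n) :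
    (walkProg 12 10).Does (memOf [n, s, w, m, x, y, l, e, d, u, v, b, a, z, q])
      (memOf [n, s, w, m, x, y, l, e, d, u, v, b, a, (z + a * v) % n, q])
      ((List.range a.toNat).map fun i : ℕ => (z + (i + 1) * v) % n) (3 + n.toNat * 20) := by
  have h := Prog.Does.iterate (e := cell 12) (N := a.toNat) (t := 19)
    (P := block [assign 13 (.mod (.add (cell 13) (cell 10)) (cell 0)), emit (cell 13)])
    (M := fun i : ℕ => memOf [n, s, w, m, x, y, l, e, d, u, v, b, a, (z + i * v) % n, q])
    (O := fun i : ℕ => [(z + (i + 1) * v) % n]) (by simp [Expr.eval, memOf]) (by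
      intro i _
      have H := Prog.Does.block_cons
          (P := assign 13 (.mod (.add (cell 13) (cell 10)) (cell 0)))
          (Prog.Does.assign (l := [n, s, w, m, x, y, l, e, d, u, v, b, a, (z + i * v) % n, q])
            (z := (z + (i + 1) * v) % n) (t := 10) (by simp)
            (by simp [Expr.eval, memOf, add_assoc, add_mul]) (by simp [Expr.cost])) <|
        Prog.Does.block_cons (P := emit (cell 13))
          (Prog.Does.emit_eq (z := (z + (i + 1) * v) % n) (t := 5) (by simp [Expr.eval, memOf])
            (by simp [Expr.cost])) <|
        Prog.Does.block_nil _
      exact H.congr (by simp) (by simp) (by simp))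
  simp only [Nat.cast_zero, zero_mul, add_zero, hz, Int.toNat_of_nonneg ha,
    ← List.map_eq_flatMap] at h
  refine Prog.Does.mono h ?_
  have : a.toNat ≤ n.toNat := by omega
  simp only [Expr.cost]
  omega

/-- The product of `n` and the tag is accumulated in cell 14 by adding `n` once per unit of the tag.
-/
theorem colourProg_does (c : Bool) (h0 : 0 ≤ if c then e else d) (hN : (if c then e else d) ≤ n) :
    (Prog.repeat (cell (if c then 7 else 8)) (assign 14 (.add (cell 14) (cell 0)))).Does
      (memOf [n, s, w, m, x, y, l, e, d, u, v, b, a, z, q])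
      (memOf [n, s, w, m, x, y, l, e, d, u, v, b, a, z, q + n * if c then e else d])
      [] (3 + n.toNat * 20) := by
  have h := Prog.Does.iterate (e := cell (if c then 7 else 8))
    (N := (if c then e else d).toNat) (t := 19)
    (P := assign 14 (.add (cell 14) (cell 0)))
    (M := fun i : ℕ => memOf [n, s, w, m, x, y, l, e, d, u, v, b, a, z, q + n * i])
    (O := fun i : ℕ => []) (by cases c <;> simp [Expr.eval, memOf]) (by
      intro i _
      exact (Prog.Does.assign (l := [n, s, w, m, x, y, l, e, d, u, v, b, a, z, q + n * i])
        (z := q + n * (i + 1)) (t := 19) (by simp)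
        (by simp [Expr.eval, memOf, mul_add, add_assoc]) (by simp [Expr.cost])).congr
        (by simp) rfl le_rfl)
  simp only [Nat.cast_zero, mul_zero, add_zero, Int.toNat_of_nonneg h0] at h
  rw [show ((List.range (if c then e else d).toNat).flatMap fun i : ℕ => ([] : List ℤ)) = [] by
    simp] at h
  refine Prog.Does.mono h ?_
  have : (if c then e else d).toNat ≤ n.toNat := by omega
  simp only [Expr.cost]
  omega

-- Symbolic execution, one `block_cons` per instruction. Cell 12 holds the signed offset until its
-- sign has been moved into cell 10, and its absolute value afterwards. Zeroing the scratch cells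
-- restores the memory, which keeps the invariants of the outer loops simple.
set_option maxHeartbeats 1000000 in
theorem recordProg_does (c : Bool) (hx0 : 0 ≤ x) (hxn : x < n) (he : 0 ≤ e) (hen : e < n)
    (hb0 : 0 ≤ longSteps s (cycDist n e)) (hbn : longSteps s (cycDist n e) ≤ n)
    (ha0 : 0 ≤ shortSteps s (cycDist n e)) (han : shortSteps s (cycDist n e) ≤ n) :
    (recordProg c).Does
      (memOf [n, s, width s, m, x, y, l, e, 0, 0, 0, 0, 0, 0, 0])
      (memOf [n, s, width s, m, x, y, l, e, 0, 0, 0, 0, 0, 0, 0])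
      (recordOut c n s x l e) (1000 + n.toNat * 60) := by
  set D := cycDist n e with hD
  set B := longSteps s D with hB
  set A := shortSteps s D with hA
  set U := cycSign n e * s with hU
  set V := cycSign n e * shortSign s D with hV
  have hD0 : 0 ≤ D := by rw [hD, cycDist]; split_ifs <;> omega
  have hDn : D ≤ n := by rw [hD, cycDist]; split_ifs <;> omega
  have hx : x % n = x := Int.emod_eq_of_lt hx0 hxn
  have H := Prog.Does.block_cons (P := .ifLt (cell 0) (.add (cell 7) (cell 7))
      (assign 8 (.sub (cell 0) (cell 7))) (assign 8 (cell 7)))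
    (Prog.Does.assignIf (l := [n, s, width s, m, x, y, l, e, 0, 0, 0, 0, 0, 0, 0]) (z := D) (t := 20)
      (by simp) (by simp [Expr.eval, memOf, hD, cycDist]) (by simp [Expr.cost])) <|
    Prog.Does.block_cons (P := .ifLt (cell 0) (.add (cell 7) (cell 7))
      (assign 9 (.sub (.const 0) (cell 1))) (assign 9 (cell 1)))
    (Prog.Does.assignIf (l := [n, s, width s, m, x, y, l, e, D, 0, 0, 0, 0, 0, 0]) (z := U) (t := 20)
      (by simp) (by simp [Expr.eval, memOf, hU, cycSign]) (by simp [Expr.cost])) <|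
    Prog.Does.block_cons (P := assign 11 (.div (.sub (.add (.add (cell 8) (cell 8)) (cell 1))
      (.const 1)) (.add (cell 1) (cell 1))))
    (Prog.Does.assign (l := [n, s, width s, m, x, y, l, e, D, U, 0, 0, 0, 0, 0]) (z := B) (t := 30)
      (by simp) (by simp [Expr.eval, memOf, hB, longSteps]) (by simp [Expr.cost])) <|
    Prog.Does.block_cons (P := assign 12 (.div (.sub (.mod (.sub (.add (.add (cell 8) (cell 8))
      (cell 1)) (.const 1)) (.add (cell 1) (cell 1))) (.sub (cell 1) (.const 1))) (.const 2)))
    (Prog.Does.assign (l := [n, s, width s, m, x, y, l, e, D, U, 0, B, 0, 0, 0])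
      (z := shortOffset s D) (t := 30)
      (by simp) (by simp [Expr.eval, memOf, shortOffset]) (by simp [Expr.cost])) <|
    Prog.Does.block_cons (P := .ifLt (cell 0) (.add (cell 7) (cell 7)) (assign 10 (.const (-1)))
      (assign 10 (.const 1)))
    (Prog.Does.assignIf (l := [n, s, width s, m, x, y, l, e, D, U, 0, B, shortOffset s D, 0, 0])
      (z := cycSign n e) (t := 20)
      (by simp) (by simp [Expr.eval, memOf, cycSign]) (by simp [Expr.cost])) <|
    Prog.Does.block_cons (P := .ifLt (cell 12) (.const 0) (assign 10 (.sub (.const 0) (cell 10)))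
      (assign 10 (cell 10)))
    (Prog.Does.assignIf
      (l := [n, s, width s, m, x, y, l, e, D, U, cycSign n e, B, shortOffset s D, 0, 0])
      (z := V) (t := 20)
      (by simp) (by simp [Expr.eval, memOf, hV, shortSign]) (by simp [Expr.cost])) <|
    Prog.Does.block_cons (P := .ifLt (cell 12) (.const 0) (assign 12 (.sub (.const 0) (cell 12)))
      (assign 12 (cell 12)))
    (Prog.Does.assignIf (l := [n, s, width s, m, x, y, l, e, D, U, V, B, shortOffset s D, 0, 0])
      (z := A) (t := 20)
      (by simp) (by simp [Expr.eval, memOf, hA, shortSteps]) (by simp [Expr.cost])) <|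
    Prog.Does.block_cons (P := emit (.add (.add (cell 11) (cell 12)) (.const 1)))
    (Prog.Does.emit_eq (m := memOf [n, s, width s, m, x, y, l, e, D, U, V, B, A, 0, 0])
      (z := B + A + 1) (t := 20) (by simp [Expr.eval, memOf]) (by simp [Expr.cost])) <|
    Prog.Does.block_cons (P := emit (cell 4))
    (Prog.Does.emit_eq (m := memOf [n, s, width s, m, x, y, l, e, D, U, V, B, A, 0, 0])
      (z := x) (t := 20) (by simp [Expr.eval, memOf]) (by simp [Expr.cost])) <|
    Prog.Does.block_cons (P := assign 13 (cell 4))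
    (Prog.Does.assign (l := [n, s, width s, m, x, y, l, e, D, U, V, B, A, 0, 0])
      (z := x) (t := 20) (by simp) (by simp [Expr.eval, memOf]) (by simp [Expr.cost])) <|
    Prog.Does.block_cons
    (walkProg_long_does (n := n) (z := x) (b := B) hx hb0 hbn) <|
    Prog.Does.block_cons
    (walkProg_short_does (n := n) (a := A) (Int.emod_emod _ _) ha0 han) <|
    Prog.Does.block_cons (P := assign 14 (.div (cell 6) (cell 2)))
    (Prog.Does.assign (l := [n, s, width s, m, x, y, l, e, D, U, V, B, A,
        ((x + B * U) % n + A * V) % n, 0])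
      (z := l / width s) (t := 20) (by simp) (by simp [Expr.eval, memOf]) (by simp [Expr.cost])) <|
    Prog.Does.block_cons
    (colourProg_does c (by split_ifs <;> assumption) (by split_ifs <;> omega)) <|
    Prog.Does.block_cons (P := emit (cell 14))
    (Prog.Does.emit_eq (z := l / width s + n * diffTag c n e) (t := 20)
      (by simp [Expr.eval, memOf, diffTag, hD]) (by simp [Expr.cost])) <|
    Prog.Does.block_cons (P := assign 8 (.const 0))
      (Prog.Does.assign (z := 0) (t := 10) (by simp) rfl (by simp [Expr.cost])) <|
    Prog.Does.block_cons (P := assign 9 (.const 0))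
      (Prog.Does.assign (z := 0) (t := 10) (by simp) rfl (by simp [Expr.cost])) <|
    Prog.Does.block_cons (P := assign 10 (.const 0))
      (Prog.Does.assign (z := 0) (t := 10) (by simp) rfl (by simp [Expr.cost])) <|
    Prog.Does.block_cons (P := assign 11 (.const 0))
      (Prog.Does.assign (z := 0) (t := 10) (by simp) rfl (by simp [Expr.cost])) <|
    Prog.Does.block_cons (P := assign 12 (.const 0))
      (Prog.Does.assign (z := 0) (t := 10) (by simp) rfl (by simp [Expr.cost])) <|
    Prog.Does.block_cons (P := assign 13 (.const 0))
      (Prog.Does.assign (z := 0) (t := 10) (by simp) rfl (by simp [Expr.cost])) <|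
    Prog.Does.block_cons (P := assign 14 (.const 0))
      (Prog.Does.assign (z := 0) (t := 10) (by simp) rfl (by simp [Expr.cost])) <|
    Prog.Does.block_nil _
  refine H.congr (by simp) ?_ ?_
  · simp only [recordOut, ← hD, ← hB, ← hA, ← hU, ← hV, List.nil_append, List.append_nil,
      Int.emod_add_emod, List.cons_append, List.append_assoc]
  · omega

/-- The output for all requests from `x` to `0, …, n - 1`. -/
def sourceOut (c : Bool) (n : ℕ) (s x l : ℤ) : List ℤ :=
  (List.range n).flatMap fun y : ℕ =>
    if 0 < ((y : ℤ) - x) % n then recordOut c n s x l (((y : ℤ) - x) % n) else []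

/-- Bounds for the numbers of steps of the paths. -/
def StepBounds (n s : ℤ) : Prop := ∀ e, 0 ≤ e → e < n →
  0 ≤ longSteps s (cycDist n e) ∧ longSteps s (cycDist n e) ≤ n ∧
    0 ≤ shortSteps s (cycDist n e) ∧ shortSteps s (cycDist n e) ≤ n

theorem requestProg_does (c : Bool) (hS : StepBounds n s) (hx0 : 0 ≤ x) (hxn : x < n) :
    (requestProg c).Does
      (memOf [n, s, width s, m, x, y, l, 0, 0, 0, 0, 0, 0, 0, 0])
      (memOf [n, s, width s, m, x, y + 1, l, 0, 0, 0, 0, 0, 0, 0, 0])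
      (if 0 < (y - x) % n then recordOut c n s x l ((y - x) % n) else [])
      (1100 + n.toNat * 60) := by
  have hn : 0 < n := by omega
  have he := Int.emod_nonneg (y - x) hn.ne'
  have hen := Int.emod_lt_of_pos (y - x) hn
  obtain ⟨h1, h2, h3, h4⟩ := hS _ he hen
  set e := (y - x) % n with hE
  have hR : (Prog.ifLt (.const 0) (cell 7) (recordProg c) .skip).Does
      (memOf [n, s, width s, m, x, y, l, e, 0, 0, 0, 0, 0, 0, 0])
      (memOf [n, s, width s, m, x, y, l, e, 0, 0, 0, 0, 0, 0, 0])
      (if 0 < e then recordOut c n s x l e else []) (1010 + n.toNat * 60) := by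
    by_cases h : 0 < e
    · rw [if_pos h]
      refine (Prog.Does.ifLt_pos (by simpa [Expr.eval, memOf] using h)
        (recordProg_does c hx0 hxn he hen h1 h2 h3 h4)).mono ?_
      simp only [Expr.cost]; omega
    · rw [if_neg h]
      refine (Prog.Does.ifLt_neg (by simpa [Expr.eval, memOf] using h) (Prog.Does.skip _)).mono ?_
      simp only [Expr.cost]; omega
  have H := Prog.Does.block_cons (P := assign 7 (.mod (.sub (cell 5) (cell 4)) (cell 0)))
      (Prog.Does.assign (l := [n, s, width s, m, x, y, l, 0, 0, 0, 0, 0, 0, 0, 0]) (z := e) (t := 20)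
        (by simp) (by simp [Expr.eval, memOf, hE]) (by simp [Expr.cost])) <|
    Prog.Does.block_cons hR <|
    Prog.Does.block_cons (P := assign 7 (.const 0))
      (Prog.Does.assign (z := 0) (t := 10) (by simp) rfl (by simp [Expr.cost])) <|
    Prog.Does.block_cons (P := assign 5 (.add (cell 5) (.const 1)))
      (Prog.Does.assign (z := y + 1) (t := 10) (by simp) (by simp [Expr.eval, memOf])
        (by simp [Expr.cost])) <|
    Prog.Does.block_nil _
  refine H.congr (by simp) ?_ ?_
  · simp
  · omega

theorem sourceProg_does (c : Bool) {n : ℕ} (hS : StepBounds n s) (hx0 : 0 ≤ x) (hxn : x < n) :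
    (sourceProg c).Does
      (memOf [n, s, width s, m, x, 0, l, 0, 0, 0, 0, 0, 0, 0, 0])
      (memOf [n, s, width s, m, x + 1, 0, (l + m) % n, 0, 0, 0, 0, 0, 0, 0, 0])
      (sourceOut c n s x l) (100 + n * (1101 + n * 60)) := by
  have hL := Prog.Does.iterate (e := cell 0) (N := n) (P := requestProg c)
    (M := fun i : ℕ => memOf [n, s, width s, m, x, i, l, 0, 0, 0, 0, 0, 0, 0, 0])
    (by simp [Expr.eval, memOf]) (fun i _ => by
      simpa using requestProg_does (y := i) (m := m) (l := l) c hS hx0 hxn)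
  have H := Prog.Does.block_cons (P := assign 5 (.const 0))
      (Prog.Does.assign (l := [(n : ℤ), s, width s, m, x, 0, l, 0, 0, 0, 0, 0, 0, 0, 0]) (z := 0)
        (t := 10) (by simp) rfl (by simp [Expr.cost])) <|
    Prog.Does.block_cons hL <|
    Prog.Does.block_cons (P := assign 5 (.const 0))
      (Prog.Does.assign (z := 0) (t := 10) (by simp) rfl (by simp [Expr.cost])) <|
    Prog.Does.block_cons (P := assign 6 (.mod (.add (cell 6) (cell 3)) (cell 0)))
      (Prog.Does.assign (z := (l + m) % n) (t := 20) (by simp) (by simp [Expr.eval, memOf])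
        (by simp [Expr.cost])) <|
    Prog.Does.block_cons (P := assign 4 (.add (cell 4) (.const 1)))
      (Prog.Does.assign (z := x + 1) (t := 20) (by simp) (by simp [Expr.eval, memOf])
        (by simp [Expr.cost])) <|
    Prog.Does.block_nil _
  refine H.congr (by simp) ?_ ?_
  · simp [sourceOut]
  · rw [show 1100 + n * 60 + 1 = 1101 + n * 60 by ring]
    generalize n * (1101 + n * 60) = k
    simp only [Expr.cost]
    omega

/-- Invariant of the outer loop: cell 6 holds the multiplier times the source modulo `n`, maintained
by one modular addition per source. Each of the `n ^ 2` pairs costs O(`n`) steps. -/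
theorem routingProg_exec (c : Bool) (n s : ℕ) (hn : 0 < n) (hS : StepBounds n s) :
    ((routingProg c).exec n s).out = ((List.range n).flatMap fun x : ℕ =>
      sourceOut c n s x ((multiplier n s * x) % n)) ∧
    ((routingProg c).exec n s).steps ≤ 2000 * n ^ 3 := by
  have hL := Prog.Does.iterate (e := cell 0) (N := n) (P := sourceProg c)
    (M := fun i : ℕ => memOf [(n : ℤ), s, width s, multiplier n s, i, 0,
      (multiplier n s * i) % n, 0, 0, 0, 0, 0, 0, 0, 0])
    (by simp [Expr.eval, memOf]) (fun i hi => by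
      simpa [mul_add] using
        sourceProg_does (m := multiplier n s) (l := (multiplier n s * i) % n) (x := i) c hS
          (by positivity) (by exact_mod_cast hi))
  simp only [Nat.cast_zero, mul_zero, Int.zero_emod] at hL
  have H := Prog.Does.block_cons (P := assign 2 (.sub (.add (cell 1) (.const 1))
        (.div (.add (cell 1) (.const 1)) (.const 6))))
      (Prog.Does.assign (l := [(n : ℤ), s, 0, 0, 0, 0, 0, 0, 0, 0, 0, 0, 0, 0, 0]) (z := width s)
        (t := 30) (by simp) (by simp [Expr.eval, memOf, width]) (by simp [Expr.cost])) <|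
    Prog.Does.block_cons (P := assign 3 (.div (.sub (.add (.add (cell 0) (cell 2)) (cell 1))
        (.const 1)) (cell 1)))
      (Prog.Does.assign (z := multiplier n s) (t := 30) (by simp)
        (by simp [Expr.eval, memOf, multiplier]) (by simp [Expr.cost])) <|
    Prog.Does.block_cons hL <|
    Prog.Does.block_nil _
  obtain ⟨t, ht, H⟩ := H
  have H' := H [] 0
  rw [Prog.exec, initConfig_eq]
  constructor
  · rw [routingProg, H']
    simp
  · rw [routingProg, H']
    simp only [Expr.cost] at ht
    have h1 : 1 ≤ n := hn
    have h2 : n ≤ n ^ 3 := Nat.le_self_pow (by norm_num) n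
    have h3 : n ^ 2 ≤ n ^ 3 := Nat.pow_le_pow_right hn (by norm_num)
    simp only [zero_add]
    refine ht.trans ?_
    ring_nf at h2 h3 ⊢
    omega

end Verification

/-! ## Lower bounds for the optical indices -/

section LowerBound

open SimpleGraph

/-- The distance of two nodes on the cycle `ℤ/n`. -/
def cycleDist {n : ℕ} (x y : ZMod n) : ℕ := (y - x).valMinAbs.natAbs

/-- Triangle inequality for the cyclic distance, iterated along the walk. -/
theorem cycleDist_le_sum_darts {n : ℕ} {G : SimpleGraph (ZMod n)} {x y : ZMod n}
    (p : G.Walk x y) : cycleDist x y ≤ (p.darts.map fun a => cycleDist a.fst a.snd).sum := by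
  induction p with
  | nil => simp [cycleDist]
  | @cons u v w h p ih =>
    simp only [Walk.darts_cons, List.map_cons, List.sum_cons]
    refine le_trans ?_ (Nat.add_le_add_left ih _)
    have := ZMod.natAbs_valMinAbs_add_le (v - u) (w - v)
    rw [show v - u + (w - v) = w - u by ring] at this
    exact this.trans (Int.natAbs_add_le _ _)

theorem sum_natAbs_valMinAbs (n : ℕ) [NeZero n] :
    ∑ e : ZMod n, e.valMinAbs.natAbs = n ^ 2 / 4 := by
  have h1 : ∑ e : ZMod n, e.valMinAbs.natAbs = ∑ i ∈ Finset.range n, min i (n - i) := by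
    -- `ZMod (k + 1)` unfolds to `Fin (k + 1)`, so the sum becomes one over a range.
    obtain ⟨k, rfl⟩ : ∃ k, n = k + 1 := Nat.exists_eq_succ_of_ne_zero (NeZero.ne n)
    simp_rw [ZMod.valMinAbs_natAbs_eq_min]
    exact Fin.sum_univ_eq_sum_range (fun i => min i (k + 1 - i)) (k + 1)
  have h2 : ∀ m : ℕ, ∑ i ∈ Finset.range m, min i (m - i) = m ^ 2 / 4 := by
    intro m
    induction m using Nat.strong_induction_on with
    | _ m ih =>
      match m with
      | 0 => simp
      | 1 => simp
      | m + 2 =>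
        -- The two end terms are 0 and 1; each of the `m` terms between them exceeds the
        -- corresponding term for `m` by 1.
        rw [Finset.sum_range_succ, Finset.sum_range_succ']
        have : ∀ i ∈ Finset.range m, min (i + 1) (m + 2 - (i + 1)) = min i (m - i) + 1 := by
          intro i hi
          have := Finset.mem_range.mp hi
          omega
        rw [Finset.sum_congr rfl this, Finset.sum_add_distrib, ih m (by omega)]
        simp only [Finset.sum_const, Finset.card_range, smul_eq_mul, mul_one]
        have : (m + 2) ^ 2 = m ^ 2 + 4 * (m + 1) := by ring
        omega
  rw [h1, h2]

theorem sum_cycleDist_requests (n : ℕ) [NeZero n] :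
    ∑ p : Request (ZMod n), cycleDist p.1.1 p.1.2 = n * (n ^ 2 / 4) := by
  have h1 : ∑ p : Request (ZMod n), cycleDist p.1.1 p.1.2 =
      ∑ p : ZMod n × ZMod n, cycleDist p.1 p.2 := by
    rw [← Finset.sum_subtype (Finset.univ.filter fun p : ZMod n × ZMod n => p.1 ≠ p.2) (by simp)
      fun p => cycleDist p.1 p.2]
    refine Finset.sum_filter_of_ne fun p _ h => ?_
    contrapose! h
    simp [cycleDist, h]
  rw [h1, Fintype.sum_prod_type]
  have h2 : ∀ x : ZMod n, ∑ y : ZMod n, cycleDist x y = n ^ 2 / 4 := by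
    intro x
    rw [← sum_natAbs_valMinAbs n]
    exact (Equiv.subRight x).sum_comp fun e : ZMod n => e.valMinAbs.natAbs
  simp [h2, ZMod.card]

/-- Each node has arcs with differences ±1 and ±s, of weight at most 1 and s. Since `w` adds the
four contributions, the bound survives coincidences among these differences. -/
theorem sum_cycleDist_darts_circ_le (n s : ℕ) [NeZero n] [Fintype (circ n s).Dart] :
    ∑ a : (circ n s).Dart, cycleDist a.fst a.snd ≤ n * (2 * (s + 1)) := by
  classical
  have hle : ∀ z : ℤ, (z : ZMod n).valMinAbs.natAbs ≤ z.natAbs := fun z =>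
    ZMod.natAbs_min_of_le_div_two n _ _ (ZMod.coe_valMinAbs _) (ZMod.natAbs_valMinAbs_le _)
  let w : ZMod n → ℕ := fun e => (if e = ((1 : ℤ) : ZMod n) then 1 else 0) +
    (if e = ((s : ℤ) : ZMod n) then s else 0) + (if e = ((-1 : ℤ) : ZMod n) then 1 else 0) +
    (if e = ((-s : ℤ) : ZMod n) then s else 0)
  have hw : ∀ a : (circ n s).Dart, cycleDist a.fst a.snd ≤ w (a.snd - a.fst) := by
    intro a
    have hadj := a.adj
    simp only [circ, SimpleGraph.circulantGraph_adj, Set.mem_insert_iff, Set.mem_singleton_iff] at hadj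
    have h : a.snd - a.fst = ((1 : ℤ) : ZMod n) ∨ a.snd - a.fst = ((s : ℤ) : ZMod n) ∨
        a.snd - a.fst = ((-1 : ℤ) : ZMod n) ∨ a.snd - a.fst = ((-s : ℤ) : ZMod n) := by
      push_cast
      rw [← neg_sub a.snd a.fst] at hadj
      generalize a.snd - a.fst = e at hadj ⊢
      simp only [neg_eq_iff_eq_neg, neg_neg] at hadj
      tauto
    rw [cycleDist]
    generalize a.snd - a.fst = e at h
    rcases h with h | h | h | h
    · have := hle 1
      rw [← h] at this
      have h' : 1 ≤ w e := by simp only [w, if_pos h]; omega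
      exact this.trans h'
    · have := hle s
      rw [← h] at this
      have h' : s ≤ w e := by simp only [w, if_pos h]; omega
      exact this.trans (by simpa using h')
    · have := hle (-1)
      rw [← h] at this
      have h' : 1 ≤ w e := by simp only [w, if_pos h]; omega
      exact this.trans h'
    · have := hle (-s)
      rw [← h] at this
      have h' : s ≤ w e := by simp only [w, if_pos h]; omega
      exact this.trans (by simpa using h')
  calc ∑ a : (circ n s).Dart, cycleDist a.fst a.snd
      ≤ ∑ a : (circ n s).Dart, w (a.snd - a.fst) := Finset.sum_le_sum fun a _ => hw a
    _ = ∑ p ∈ Finset.univ.image (SimpleGraph.Dart.toProd : (circ n s).Dart → _),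
          w (p.2 - p.1) :=
        (Finset.sum_image (f := fun p : ZMod n × ZMod n => w (p.2 - p.1))
          fun _ _ _ _ h => SimpleGraph.Dart.toProd_injective h).symm
    _ ≤ ∑ p : ZMod n × ZMod n, w (p.2 - p.1) :=
        Finset.sum_le_sum_of_subset (Finset.subset_univ _)
    _ = ∑ x : ZMod n, ∑ y : ZMod n, w (y - x) := Fintype.sum_prod_type _
    _ = ∑ x : ZMod n, ∑ e : ZMod n, w e :=
        Finset.sum_congr rfl fun x _ => (Equiv.subRight x).sum_comp w
    _ = n * (2 * (s + 1)) := by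
        simp only [w, Finset.sum_add_distrib, Finset.sum_ite_eq', Finset.mem_univ, if_true,
          Finset.sum_const, Finset.card_univ, ZMod.card, smul_eq_mul]
        ring

/-- The number of paths of a routing that traverse a given arc. -/
noncomputable def arcLoad {V : Type*} {G : SimpleGraph V} (R : Routing G) (a : G.Dart) : ℕ :=
  Set.ncard {p : Request V | a ∈ (R p).1.darts}

/-- Double counting of the pairs of a request and an arc on its path; a path uses an arc at most
once. -/
theorem sum_cycleDist_requests_le {n : ℕ} [NeZero n] {G : SimpleGraph (ZMod n)} [Fintype G.Dart]
    (R : Routing G) :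
    ∑ p : Request (ZMod n), cycleDist p.1.1 p.1.2 ≤
      ∑ a : G.Dart, cycleDist a.fst a.snd * arcLoad R a := by
  classical
  have h1 : ∀ p : Request (ZMod n), cycleDist p.1.1 p.1.2 ≤
      ∑ a : G.Dart, if a ∈ (R p).1.darts then cycleDist a.fst a.snd else 0 := by
    intro p
    refine (cycleDist_le_sum_darts (R p).1).trans ?_
    rw [← List.sum_toFinset _ (Walk.darts_nodup_of_support_nodup (R p).2.support_nodup),
      ← Finset.sum_filter]
    refine le_of_eq (Finset.sum_congr ?_ fun _ _ => rfl)
    ext a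
    simp
  refine (Finset.sum_le_sum fun p _ => h1 p).trans ?_
  rw [Finset.sum_comm]
  refine le_of_eq (Finset.sum_congr rfl fun a _ => ?_)
  rw [← Finset.sum_filter, Finset.sum_const, smul_eq_mul, mul_comm, arcLoad, Set.ncard_eq_toFinset_card']
  congr 2
  ext p
  simp

theorem arcLoad_le {V : Type*} {G : SimpleGraph V} {R : Routing G} {k : ℕ}
    {f : Request V → Fin k} (hf : ArcConflictFree R f) (a : G.Dart) : arcLoad R a ≤ k := by
  have := Set.ncard_le_ncard_of_injOn f (s := {p : Request V | a ∈ (R p).1.darts})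
    (t := Set.univ) (fun _ _ => Set.mem_univ _) (fun p hp q hq h => by
      by_contra hne
      exact hf p q hne ⟨a, hp, hq⟩ h) Set.finite_univ
  simpa [Set.ncard_univ, arcLoad] using this

/-- A path repeats no edge, so it cannot traverse both an arc and its reverse. The two sets of paths
are therefore disjoint, and all their members conflict at the one edge. -/
theorem arcLoad_add_arcLoad_symm_le {V : Type*} [Finite V] {G : SimpleGraph V} {R : Routing G}
    {k : ℕ} {f : Request V → Fin k} (hf : EdgeConflictFree R f) (a : G.Dart) :
    arcLoad R a + arcLoad R a.symm ≤ k := by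
  have hd : Disjoint {p : Request V | a ∈ (R p).1.darts} {p | a.symm ∈ (R p).1.darts} := by
    rw [Set.disjoint_left]
    intro p hp hq
    have hn := (R p).2.isTrail.edges_nodup
    rw [Walk.edges_eq_map_darts] at hn
    exact a.symm_ne (List.inj_on_of_nodup_map hn hq hp (Dart.edge_symm a))
  rw [arcLoad, arcLoad, ← Set.ncard_union_eq hd (Set.toFinite _) (Set.toFinite _)]
  have hedge : ∀ p ∈ {p : Request V | a ∈ (R p).1.darts} ∪ {p | a.symm ∈ (R p).1.darts},
      a.edge ∈ (R p).1.edges := by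
    rintro p (hp | hp) <;> rw [Walk.edges_eq_map_darts]
    · exact List.mem_map_of_mem hp
    · rw [← Dart.edge_symm a]
      exact List.mem_map_of_mem hp
  have := Set.ncard_le_ncard_of_injOn f
    (s := {p : Request V | a ∈ (R p).1.darts} ∪ {p | a.symm ∈ (R p).1.darts})
    (t := Set.univ) (fun _ _ => Set.mem_univ _) (fun p hp q hq h => by
      by_contra hne
      exact hf p q hne ⟨a.edge, hedge p hp, hedge q hq⟩ h) Set.finite_univ
  simpa [Set.ncard_univ] using this

theorem le_of_arcConflictFree {n s k : ℕ} [NeZero n] {R : Routing (circ n s)}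
    {f : Request (ZMod n) → Fin k} (hf : ArcConflictFree R f) :
    n ^ 2 / 4 ≤ 2 * (s + 1) * k := by
  classical
  have : Fintype (circ n s).Dart := Fintype.ofFinite _
  have h := (sum_cycleDist_requests_le R).trans
    (Finset.sum_le_sum fun a _ => Nat.mul_le_mul_left _ (arcLoad_le hf a))
  rw [sum_cycleDist_requests, ← Finset.sum_mul] at h
  have h' := h.trans (Nat.mul_le_mul_right k (sum_cycleDist_darts_circ_le n s))
  rw [mul_assoc] at h'
  exact Nat.le_of_mul_le_mul_left h' (NeZero.pos n)

theorem le_of_edgeConflictFree {n s k : ℕ} [NeZero n] {R : Routing (circ n s)}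
    {f : Request (ZMod n) → Fin k} (hf : EdgeConflictFree R f) :
    n ^ 2 / 4 ≤ (s + 1) * k := by
  classical
  have : Fintype (circ n s).Dart := Fintype.ofFinite _
  have h := sum_cycleDist_requests_le R
  -- Reversing arcs preserves weights, so the loads of an arc and its reverse can be paired; this
  -- gains the factor 2 over the oriented bound.
  have hsymm : ∑ a : (circ n s).Dart, cycleDist a.fst a.snd * arcLoad R a =
      ∑ a : (circ n s).Dart, cycleDist a.fst a.snd * arcLoad R a.symm := by
    rw [← Equiv.sum_comp (Function.Involutive.toPerm _ Dart.symm_involutive)]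
    refine Finset.sum_congr rfl fun a _ => ?_
    have : cycleDist a.snd a.fst = cycleDist a.fst a.snd := by
      rw [cycleDist, ← ZMod.natAbs_valMinAbs_neg, neg_sub, cycleDist]
    simpa using Or.inl this
  have h2 : 2 * ∑ a : (circ n s).Dart, cycleDist a.fst a.snd * arcLoad R a ≤
      (∑ a : (circ n s).Dart, cycleDist a.fst a.snd) * k := by
    rw [two_mul]
    nth_rw 2 [hsymm]
    rw [← Finset.sum_add_distrib, Finset.sum_mul]
    refine Finset.sum_le_sum fun a _ => ?_
    rw [← mul_add]
    exact Nat.mul_le_mul_left _ (arcLoad_add_arcLoad_symm_le hf a)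
  rw [sum_cycleDist_requests] at h
  have h3 := h2.trans (Nat.mul_le_mul_right k (sum_cycleDist_darts_circ_le n s))
  have h4 : n * (n ^ 2 / 4) ≤ n * ((s + 1) * k) := by nlinarith
  exact Nat.le_of_mul_le_mul_left h4 (NeZero.pos n)

/-- An injective colouring has no conflicts. Hence the infimum over numbers of colours is attained,
and is not the default value of `sInf ∅`. -/
theorem exists_edgeConflictFree {V : Type*} [Finite V] {G : SimpleGraph V} (R : Routing G) :
    ∃ k, ∃ f : Request V → Fin k, EdgeConflictFree R f :=
  ⟨Nat.card (Request V), Finite.equivFin _, fun _ _ h _ h' => h ((Finite.equivFin _).injective h')⟩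

theorem exists_arcConflictFree {V : Type*} [Finite V] {G : SimpleGraph V} (R : Routing G) :
    ∃ k, ∃ f : Request V → Fin k, ArcConflictFree R f :=
  ⟨Nat.card (Request V), Finite.equivFin _, fun _ _ h _ h' => h ((Finite.equivFin _).injective h')⟩

/-- The argument `R` only shows that some routing exists; otherwise the index would be `sInf ∅ = 0`.
-/
theorem le_opticalIndex {n s : ℕ} [NeZero n] (R : Routing (circ n s)) :
    n ^ 2 / 4 ≤ (s + 1) * opticalIndex (circ n s) := by
  obtain ⟨R', hR'⟩ := Nat.sInf_mem (s := {k : ℕ | ∃ R : Routing (circ n s), k = edgeColourNumber R})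
    ⟨_, R, rfl⟩
  obtain ⟨f, hf⟩ := Nat.sInf_mem (exists_edgeConflictFree R')
  rw [opticalIndex, hR']
  exact le_of_edgeConflictFree hf

theorem le_directedOpticalIndex {n s : ℕ} [NeZero n] (R : Routing (circ n s)) :
    n ^ 2 / 4 ≤ 2 * (s + 1) * directedOpticalIndex (circ n s) := by
  obtain ⟨R', hR'⟩ := Nat.sInf_mem (s := {k : ℕ | ∃ R : Routing (circ n s), k = arcColourNumber R})
    ⟨_, R, rfl⟩
  obtain ⟨f, hf⟩ := Nat.sInf_mem (exists_arcConflictFree R')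
  rw [directedOpticalIndex, hR']
  exact le_of_arcConflictFree hf

end LowerBound

/-! ## The routing and its colouring -/

theorem exists_walk_of_nodes {V : Type*} {G : SimpleGraph V} (g : ℕ → V) (k : ℕ)
    (h : ∀ i < k, G.Adj (g i) (g (i + 1))) :
    ∃ p : G.Walk (g 0) (g k), p.support = (List.range (k + 1)).map g ∧
      ∀ a ∈ p.darts, ∃ i < k, a.fst = g i ∧ a.snd = g (i + 1) := by
  induction k with
  | zero => exact ⟨.nil, by simp, by simp⟩
  | succ k ih =>
    obtain ⟨p, hp, hd⟩ := ih fun i hi => h i (by omega)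
    refine ⟨p.concat (h k (by omega)), ?_, fun a ha => ?_⟩
    · rw [SimpleGraph.Walk.support_concat, hp, List.range_succ (n := k + 1)]
      simp
    · rw [SimpleGraph.Walk.darts_concat, List.concat_eq_append, List.mem_append,
        List.mem_singleton] at ha
      rcases ha with ha | rfl
      · obtain ⟨i, hi, h'⟩ := hd a ha
        exact ⟨i, by omega, h'⟩
      · exact ⟨k, by omega, rfl, rfl⟩

theorem exists_path_of_nodes {V : Type*} {G : SimpleGraph V} (g : ℕ → V) (k : ℕ)
    (h : ∀ i < k, G.Adj (g i) (g (i + 1))) (hg : ∀ i ≤ k, ∀ j ≤ k, g i = g j → i = j)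
    {x y : V} (hx : g 0 = x) (hy : g k = y) :
    ∃ p : G.Path x y, p.1.support = (List.range (k + 1)).map g ∧
      ∀ a ∈ p.1.darts, ∃ i < k, a.fst = g i ∧ a.snd = g (i + 1) := by
  subst hx hy
  obtain ⟨p, hp, hd⟩ := exists_walk_of_nodes g k h
  refine ⟨⟨p, ?_⟩, hp, hd⟩
  rw [SimpleGraph.Walk.isPath_def, hp]
  refine List.nodup_range.map_on fun i hi j hj hij => hg i ?_ j ?_ hij
  · have := List.mem_range.mp hi; omega
  · have := List.mem_range.mp hj; omega

/-! ### Geometry of a single path -/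

section Steps

variable {n s d : ℤ}

/-- `longSteps` rounds `d / s` to the nearest integer, ties downwards. The tie rule gives the `- 1`
in the last bound, which `abs_longMul_bounds` needs when `width s = s + 1`. -/
theorem longSteps_spec (hs : 3 ≤ s) :
    d = longSteps s d * s + shortSign s d * shortSteps s d ∧ 0 ≤ shortSteps s d ∧
      2 * shortSteps s d ≤ s ∧ 2 * (longSteps s d * s) ≤ 2 * d + s - 1 := by
  have h1 := Int.mul_ediv_add_emod (d + d + s - 1) (s + s)
  have h2 := Int.emod_nonneg (d + d + s - 1) (b := s + s) (by omega)
  have h3 := Int.emod_lt_of_pos (d + d + s - 1) (b := s + s) (by omega)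
  have h4 : shortOffset s d = d - longSteps s d * s := by
    unfold shortOffset longSteps
    have : (d + d + s - 1) % (s + s) - (s - 1) = 2 * (d - (d + d + s - 1) / (s + s) * s) := by
      linarith
    omega
  have h5 : 2 * shortOffset s d ≤ s ∧ -s ≤ 2 * shortOffset s d := by
    unfold shortOffset; omega
  have h6 : 2 * (longSteps s d * s) ≤ 2 * d + s - 1 := by
    unfold longSteps; linarith
  refine ⟨?_, ?_, ?_, h6⟩
  · unfold shortSign shortSteps
    split_ifs <;> linarith
  · unfold shortSteps; split_ifs <;> omega
  · unfold shortSteps; split_ifs <;> omega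

theorem longSteps_nonneg (hs : 3 ≤ s) (hd : 0 ≤ d) : 0 ≤ longSteps s d :=
  Int.ediv_nonneg (by omega) (by omega)

theorem shortSign_eq (s d : ℤ) : shortSign s d = 1 ∨ shortSign s d = -1 := by
  unfold shortSign; split_ifs <;> simp

theorem cycSign_eq (n e : ℤ) : cycSign n e = 1 ∨ cycSign n e = -1 := by
  unfold cycSign; split_ifs <;> simp

theorem cycDist_nonneg {e : ℤ} (he : 0 ≤ e) (hen : e < n) : 0 ≤ cycDist n e := by
  unfold cycDist; split_ifs <;> omega

theorem two_mul_cycDist_le {e : ℤ} : 2 * cycDist n e ≤ n := by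
  unfold cycDist; split_ifs <;> omega

/-- The displacement after `i` steps on the path of a request of length `d`. -/
def displacement (s d : ℤ) (i : ℕ) : ℤ :=
  if (i : ℤ) ≤ longSteps s d then i * s
  else longSteps s d * s + shortSign s d * (i - longSteps s d)

/-- The step number `i` on the path of a request of length `d`. -/
def stepAt (s d : ℤ) (i : ℕ) : ℤ := if (i : ℤ) < longSteps s d then s else shortSign s d

/-- The number of steps on the path of a request of length `d`. -/
def stepCount (s d : ℤ) : ℕ := (longSteps s d + shortSteps s d).toNat

theorem displacement_succ (s d : ℤ) (i : ℕ) :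
    displacement s d (i + 1) = displacement s d i + stepAt s d i := by
  unfold displacement stepAt
  push_cast
  by_cases h1 : (i : ℤ) < longSteps s d
  · rw [if_pos (by omega), if_pos h1.le, if_pos h1]
    ring
  · rw [if_neg (by omega), if_neg h1]
    split_ifs with h2
    · have : (i : ℤ) = longSteps s d := by omega
      rw [← this]
      ring
    · ring

theorem displacement_stepCount (hs : 3 ≤ s) (hd : 0 ≤ d) : displacement s d (stepCount s d) = d := by
  obtain ⟨h1, h2, -⟩ := longSteps_spec (d := d) hs
  have h3 := longSteps_nonneg hs hd
  unfold displacement stepCount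
  rw [Int.toNat_of_nonneg (by omega)]
  split_ifs with h
  · have h0 : shortSteps s d = 0 := by omega
    rw [h0, mul_zero, add_zero] at h1
    rw [h0, add_zero, ← h1]
  · rw [add_sub_cancel_left, ← h1]

/-- The long part overshoots `d` by less than s/2, so the path never wraps around the cycle. A
backward short part is preceded by at least one long step, so it stays above 0. -/
theorem displacement_mem (hs : 3 ≤ s) (hd : 0 ≤ d) (hdn : 2 * d ≤ n) (hn : 2 * s ≤ n) {i : ℕ}
    (hi : i ≤ stepCount s d) : 0 ≤ displacement s d i ∧ displacement s d i < n := by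
  obtain ⟨h1, h2, h3, h4⟩ := longSteps_spec (d := d) hs
  have h5 := longSteps_nonneg hs hd
  have hi' : (i : ℤ) ≤ longSteps s d + shortSteps s d := by unfold stepCount at hi; omega
  unfold displacement
  split_ifs with h
  · refine ⟨by positivity, ?_⟩
    have := mul_le_mul_of_nonneg_right h (by omega : 0 ≤ s)
    omega
  · rcases shortSign_eq s d with hσ | hσ <;> rw [hσ] at h1 ⊢
    · have := mul_nonneg h5 (by omega : 0 ≤ s)
      omega
    · have hB : 1 ≤ longSteps s d := by
        by_contra hB
        have hB' : longSteps s d = 0 := by omega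
        rw [hB', zero_mul] at h1
        omega
      have := mul_le_mul_of_nonneg_right hB (by omega : 0 ≤ s)
      omega

/-- The short part stays within s/2 of the last multiple of `s`, so it meets no earlier one. -/
theorem displacement_injOn (hs : 3 ≤ s) (hd : 0 ≤ d) {i j : ℕ}
    (hi : i ≤ stepCount s d) (hj : j ≤ stepCount s d)
    (h : displacement s d i = displacement s d j) : i = j := by
  obtain ⟨h1, h2, h3, h4⟩ := longSteps_spec (d := d) hs
  have h5 := longSteps_nonneg hs hd
  have key : ∀ i j : ℕ, i ≤ stepCount s d → j ≤ stepCount s d → i < j →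
      displacement s d i ≠ displacement s d j := by
    intro i j hi hj hij h
    have hj' : (j : ℤ) ≤ longSteps s d + shortSteps s d := by unfold stepCount at hj; omega
    unfold displacement at h
    split_ifs at h with h6 h7 h7
    · have := mul_right_cancel₀ (by omega : s ≠ 0) h
      omega
    · rcases eq_or_lt_of_le h6 with h8 | h8
      · rw [h8] at h
        rcases shortSign_eq s d with hσ | hσ <;> rw [hσ] at h <;> omega
      · have h9 : ((i : ℤ) + 1) * s ≤ longSteps s d * s :=
          mul_le_mul_of_nonneg_right (by omega) (by omega)
        rw [add_mul] at h9
        rcases shortSign_eq s d with hσ | hσ <;> rw [hσ] at h <;> omega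
    · omega
    · rcases shortSign_eq s d with hσ | hσ <;> rw [hσ] at h <;> omega
  rcases lt_trichotomy i j with hij | hij | hij
  · exact absurd h (key i j hi hj hij)
  · exact hij
  · exact absurd h.symm (key j i hj hi hij)

end Steps

theorem stepBounds (n s : ℤ) (hs : 3 ≤ s) (hn : 2 * s ≤ n) {e : ℤ} (he : 0 ≤ e) (hen : e < n) :
    0 ≤ longSteps s (cycDist n e) ∧ longSteps s (cycDist n e) ≤ n ∧
      0 ≤ shortSteps s (cycDist n e) ∧ shortSteps s (cycDist n e) ≤ n := by
  obtain ⟨h1, h2, h3, h4⟩ := longSteps_spec (d := cycDist n e) hs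
  have h5 := longSteps_nonneg hs (cycDist_nonneg he hen)
  have h6 := two_mul_cycDist_le (n := n) (e := e)
  have h7 := mul_le_mul_of_nonneg_left hs h5
  omega

/-- The node after `i` steps on the path from `x` with difference `e`. -/
def pathNode (n : ℕ) (s x e : ℤ) (i : ℕ) : ZMod n :=
  ((x + cycSign n e * displacement s (cycDist n e) i : ℤ) : ZMod n)

section Nodes

variable {n : ℕ} {s x e : ℤ}

theorem pathNode_succ (i : ℕ) : pathNode n s x e (i + 1) =
    pathNode n s x e i + ((cycSign n e * stepAt s (cycDist n e) i : ℤ) : ZMod n) := by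
  unfold pathNode
  rw [displacement_succ]
  push_cast
  ring

theorem eq_of_intCast_eq {a b : ℤ} (h : (a : ZMod n) = (b : ZMod n)) (hab : |a - b| < n) :
    a = b := by
  have := (ZMod.intCast_eq_intCast_iff_dvd_sub b a n).mp h.symm
  exact sub_eq_zero.mp (Int.eq_zero_of_abs_lt_dvd this hab)

theorem pathNode_injOn (hs : 3 ≤ s) (hn : 2 * s ≤ n) (he : 0 ≤ e) (hen : e < n) {i j : ℕ}
    (hi : i ≤ stepCount s (cycDist n e)) (hj : j ≤ stepCount s (cycDist n e))
    (h : pathNode n s x e i = pathNode n s x e j) : i = j := by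
  have hd := cycDist_nonneg he hen
  have hi' := displacement_mem hs hd two_mul_cycDist_le hn hi
  have hj' := displacement_mem hs hd two_mul_cycDist_le hn hj
  refine displacement_injOn hs hd hi hj ?_
  have h' := eq_of_intCast_eq h (by
    rw [abs_lt]
    rcases cycSign_eq n e with h | h <;> rw [h] <;> constructor <;> linarith)
  rcases cycSign_eq n e with h | h <;> rw [h] at h' <;> linarith

theorem stepAt_eq (s d : ℤ) (i : ℕ) : stepAt s d i = s ∨ stepAt s d i = 1 ∨ stepAt s d i = -1 := by
  unfold stepAt
  rcases shortSign_eq s d with h | h <;> split_ifs <;> simp [h]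

theorem pathNode_adj {n s : ℕ} (hs : 3 ≤ s) (hn : 2 * s ≤ n) (he : 0 ≤ e) (hen : e < n) {i : ℕ}
    (hi : i < stepCount s (cycDist n e)) :
    (circ n s).Adj (pathNode n s x e i) (pathNode n s x e (i + 1)) := by
  rw [circ, SimpleGraph.circulantGraph_adj]
  refine ⟨fun h => ?_, Or.inr ?_⟩
  · have := pathNode_injOn (by exact_mod_cast hs) (by exact_mod_cast hn) he hen hi.le hi h
    omega
  · rw [pathNode_succ, add_sub_cancel_left]
    rcases stepAt_eq s (cycDist n e) i with h | h | h <;>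
      rcases cycSign_eq n e with h' | h' <;> rw [h, h'] <;> simp

theorem pathNode_zero : pathNode n s x e 0 = x ∨ longSteps s (cycDist n e) < 0 := by
  by_cases h : 0 ≤ longSteps s (cycDist n e)
  · left
    simp [pathNode, displacement, h]
  · exact Or.inr (not_le.mp h)

theorem pathNode_stepCount {y : ℤ} (hs : 3 ≤ s) (he : 0 ≤ e) (hen : e < n)
    (hy : (e : ZMod n) = y - x) :
    pathNode n s x e (stepCount s (cycDist n e)) = y := by
  unfold pathNode
  rw [displacement_stepCount hs (cycDist_nonneg he hen)]
  have : ((cycSign n e * cycDist n e : ℤ) : ZMod n) = e := by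
    unfold cycSign cycDist
    split_ifs <;> push_cast <;> simp
  rw [Int.cast_add, this, hy]
  ring

end Nodes

/-- The difference of a request. -/
def reqDiff {n : ℕ} (p : Request (ZMod n)) : ℤ := ((p.1.2.val : ℤ) - p.1.1.val) % n

section Requests

variable {n : ℕ} [NeZero n] (p : Request (ZMod n))

theorem reqDiff_nonneg : 0 ≤ reqDiff p := Int.emod_nonneg _ (by exact_mod_cast NeZero.ne n)

theorem reqDiff_lt : reqDiff p < n := Int.emod_lt_of_pos _ (by exact_mod_cast NeZero.pos n)

theorem intCast_reqDiff : (reqDiff p : ZMod n) = p.1.2 - p.1.1 := by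
  rw [reqDiff, ZMod.intCast_mod]
  simp

theorem exists_routing (s : ℕ) (hs : 3 ≤ s) (hn : 2 * s ≤ n) :
    ∃ R : Routing (circ n s), ∀ p : Request (ZMod n),
      (R p).1.support = (List.range (stepCount s (cycDist n (reqDiff p)) + 1)).map
        (pathNode n s p.1.1.val (reqDiff p)) ∧
      ∀ a ∈ (R p).1.darts, ∃ i < stepCount s (cycDist n (reqDiff p)),
        a.fst = pathNode n s p.1.1.val (reqDiff p) i ∧
          a.snd = pathNode n s p.1.1.val (reqDiff p) (i + 1) := by
  have hs' : (3 : ℤ) ≤ s := by exact_mod_cast hs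
  have hn' : 2 * (s : ℤ) ≤ n := by exact_mod_cast hn
  have key := fun p : Request (ZMod n) =>
    exists_path_of_nodes (G := circ n s) (x := p.1.1) (y := p.1.2)
      (pathNode n s p.1.1.val (reqDiff p)) (stepCount s (cycDist n (reqDiff p)))
      (fun i hi => pathNode_adj hs hn (reqDiff_nonneg p) (reqDiff_lt p) hi)
      (fun i hi j hj => pathNode_injOn hs' hn' (reqDiff_nonneg p) (reqDiff_lt p) hi hj)
      (by
        rcases pathNode_zero (n := n) (s := s) (x := p.1.1.val) (e := reqDiff p) with h | h
        · rw [h]; simp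
        · exact absurd h (not_lt.mpr
            (longSteps_nonneg hs' (cycDist_nonneg (reqDiff_nonneg p) (reqDiff_lt p)))))
      (by
        rw [pathNode_stepCount (y := p.1.2.val) hs' (reqDiff_nonneg p) (reqDiff_lt p)
          (by rw [intCast_reqDiff]; simp)]
        simp)
  choose R hR using key
  exact ⟨R, hR⟩

end Requests

/-- The colour class of a source among the requests with the same tag. -/
def sourceColour (n s x : ℤ) : ℤ := (multiplier n s * x) % n / width s

/-- The colour of a request. -/
def reqColour (c : Bool) {n : ℕ} (s : ℤ) (p : Request (ZMod n)) : ℤ :=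
  sourceColour n s p.1.1.val + n * diffTag c n (reqDiff p)

/-! ### Separation of sources by the multiplier -/

section Colours

/-- The width is ⌈5(s+1)/6⌉. The factor 5/6 is small enough for (s-1)w ≤ n, as 5/6 · 9/8 < 1, and
large enough for the ratio, as 4 · 6/5 < 4.85. -/
theorem width_bounds {s : ℤ} (hs : 3 ≤ s) : 0 < width s ∧ width s ≤ s + 1 ∧
    5 * (s + 1) ≤ 6 * width s ∧ 6 * width s ≤ 5 * (s + 1) + 5 := by
  unfold width; omega

/-- The multiplier is ⌈(n+w)/s⌉, so moving a source by `s` moves its multiple modulo `n` by at least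
w and at most w + s - 1. -/
theorem multiplier_bounds {n s : ℤ} (hs : 3 ≤ s) :
    n + width s ≤ s * multiplier n s ∧ s * multiplier n s ≤ n + width s + s - 1 := by
  have h1 := Int.mul_ediv_add_emod (n + width s + s - 1) s
  have h2 := Int.emod_nonneg (n + width s + s - 1) (b := s) (by omega)
  have h3 := Int.emod_lt_of_pos (n + width s + s - 1) (b := s) (by omega)
  unfold multiplier
  constructor <;> omega

theorem abs_sub_lt_of_ediv_eq {a b w : ℤ} (hw : 0 < w) (h : a / w = b / w) : |a - b| < w := by
  have h1 := Int.mul_ediv_add_emod a w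
  have h2 := Int.emod_nonneg a hw.ne'
  have h3 := Int.emod_lt_of_pos a hw
  have h4 := Int.mul_ediv_add_emod b w
  have h5 := Int.emod_nonneg b hw.ne'
  have h6 := Int.emod_lt_of_pos b hw
  rw [h] at h1
  rw [abs_lt]
  constructor <;> linarith

/-- Residues in one block differ by some δ with |δ| < w. Then |δ - K| < n and n ∣ δ - K, so δ = K,
against w ≤ |K|. -/
theorem sourceColour_ne {n s x x' K : ℤ} (hs : 3 ≤ s)
    (hK : n ∣ multiplier n s * (x - x') - K) (h1 : width s ≤ |K|) (h2 : |K| ≤ n - width s) :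
    sourceColour n s x ≠ sourceColour n s x' := by
  intro h
  have h3 := abs_sub_lt_of_ediv_eq (width_bounds hs).1 h
  have h4 : n ∣ (multiplier n s * x) % n - (multiplier n s * x') % n - K := by
    have h5 := Int.mul_ediv_add_emod (multiplier n s * x) n
    have h6 := Int.mul_ediv_add_emod (multiplier n s * x') n
    have : (multiplier n s * x) % n - (multiplier n s * x') % n - K =
        (multiplier n s * (x - x') - K) +
          n * ((multiplier n s * x') / n - (multiplier n s * x) / n) := by linarith
    rw [this]
    exact dvd_add hK (dvd_mul_right _ _)
  generalize (multiplier n s * x) % n - (multiplier n s * x') % n = δ at h3 h4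
  have h5 : δ - K = 0 := Int.eq_zero_of_abs_lt_dvd h4 (by
    have := abs_sub δ K
    omega)
  have h6 : δ = K := by omega
  subst h6
  omega

variable {n s : ℤ}

/-- With B long steps, each contributing between w and 2s, one gets (B-1)·2s ≤ 2d - s - 1 ≤ n - w,
because w ≤ s + 1. -/
theorem abs_longMul_bounds (hs : 3 ≤ s) {d k : ℤ} (hd : 2 * d ≤ n) (hk : k ≠ 0)
    (hkB : |k| < longSteps s d) :
    width s ≤ |k * (s * multiplier n s - n)| ∧
      |k * (s * multiplier n s - n)| ≤ n - width s := by
  obtain ⟨hw0, hw1, -⟩ := width_bounds hs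
  obtain ⟨hm1, hm2⟩ := multiplier_bounds (n := n) hs
  obtain ⟨-, -, -, hB⟩ := longSteps_spec (d := d) hs
  have hk1 : 1 ≤ |k| := Int.one_le_abs hk
  rw [abs_mul, abs_of_nonneg (by omega : 0 ≤ s * multiplier n s - n)]
  constructor
  · nlinarith
  · have h1 : |k| * (s * multiplier n s - n) ≤ (longSteps s d - 1) * (2 * s) :=
      mul_le_mul (by omega) (by omega) (by omega) (by omega)
    have h2 : (longSteps s d - 1) * (2 * s) = 2 * (longSteps s d * s) - 2 * s := by ring
    omega

/-- Each short step contributes m, and `hw` gives m ≥ w. Since |k| ≤ s/2 - 1, the total is at most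
sm/2 - m, about half of n. -/
theorem abs_shortMul_bounds (hs : 3 ≤ s) (hn : 4 * s + 2 ≤ n) (hw : (s - 1) * width s ≤ n)
    {d k : ℤ} (hk : k ≠ 0) (hkA : |k| < shortSteps s d) :
    width s ≤ |k * multiplier n s| ∧ |k * multiplier n s| ≤ n - width s := by
  obtain ⟨hw0, hw1, -⟩ := width_bounds hs
  obtain ⟨hm1, hm2⟩ := multiplier_bounds (n := n) hs
  obtain ⟨-, -, hA, -⟩ := longSteps_spec (d := d) hs
  have hk1 : 1 ≤ |k| := Int.one_le_abs hk
  have hm : width s ≤ multiplier n s := by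
    have : s * width s ≤ s * multiplier n s := by linarith
    exact le_of_mul_le_mul_left this (by omega)
  rw [abs_mul, abs_of_nonneg (by omega : 0 ≤ multiplier n s)]
  constructor
  · nlinarith
  · have h1 : 2 * |k| * multiplier n s ≤ (s - 2) * multiplier n s :=
      mul_le_mul_of_nonneg_right (by omega) (by omega)
    have h2 : (s - 2) * multiplier n s = s * multiplier n s - 2 * multiplier n s := by ring
    rw [mul_assoc] at h1
    omega

end Colours

/-! ### Paths that share an arc -/

section Conflicts

variable {n : ℕ} {s x x' e e' : ℤ}

/-- The steps ±s and ±1 are distinct modulo `n`, so an arc reveals whether it is long or short. For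
a fixed length `d` the short steps have a fixed sign relative to the long ones, so the arc also
reveals the direction of the request. -/
theorem sign_mul_stepAt_eq (hs : 3 ≤ s) (hn : 4 * s + 2 ≤ n) {d : ℤ} {i i' : ℕ}
    {ε ε' : ℤ} (hε : ε = 1 ∨ ε = -1) (hε' : ε' = 1 ∨ ε' = -1)
    (h : ((ε * stepAt s d i : ℤ) : ZMod n) = ((ε' * stepAt s d i' : ℤ) : ZMod n)) :
    ε = ε' ∧ ((i : ℤ) < longSteps s d ↔ (i' : ℤ) < longSteps s d) := by
  have h' := eq_of_intCast_eq h (by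
    rw [abs_lt]
    rcases stepAt_eq s d i with h1 | h1 | h1 <;> rcases stepAt_eq s d i' with h2 | h2 | h2 <;>
      rcases hε with h3 | h3 <;> rcases hε' with h4 | h4 <;> rw [h1, h2, h3, h4] <;>
      constructor <;> omega)
  unfold stepAt at h'
  rcases shortSign_eq s d with h1 | h1 <;> rcases hε with h3 | h3 <;>
    rcases hε' with h4 | h4 <;> rw [h1, h3, h4] at h' <;> rw [h3, h4] <;>
    split_ifs at h' <;> omega

theorem eq_of_common_arc (hs : 3 ≤ s) (hn : 4 * s + 2 ≤ n) (hw : (s - 1) * width s ≤ n)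
    (he : cycDist n e = cycDist n e') {i i' : ℕ}
    (hi : i < stepCount s (cycDist n e)) (hi' : i' < stepCount s (cycDist n e'))
    (h1 : pathNode n s x e i = pathNode n s x' e' i')
    (h2 : pathNode n s x e (i + 1) = pathNode n s x' e' (i' + 1))
    (hc : sourceColour n s x = sourceColour n s x') :
    cycSign n e = cycSign n e' ∧ (x : ZMod n) = x' := by
  rw [pathNode_succ, pathNode_succ, h1, ← he] at h2
  obtain ⟨hε, hB⟩ := sign_mul_stepAt_eq hs hn (cycSign_eq n e) (cycSign_eq n e')
    (add_left_cancel h2)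
  refine ⟨hε, ?_⟩
  unfold pathNode at h1
  rw [← he] at h1 hi'
  rw [← hε] at h1
  have h3 := (ZMod.intCast_eq_intCast_iff_dvd_sub _ _ n).mp h1.symm
  unfold stepCount at hi hi'
  set d := cycDist n e
  set ε := cycSign n e with hεd
  have hdn : 2 * d ≤ n := two_mul_cycDist_le
  by_contra hx
  have hii : (i' : ℤ) - i ≠ 0 := by
    intro h
    have : i = i' := by omega
    subst this
    rw [Int.cast_add, Int.cast_add] at h1
    exact hx (add_right_cancel h1)
  have hεabs : |ε| = 1 := by rcases cycSign_eq n e with h | h <;> rw [hεd, h] <;> simp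
  by_cases hiB : (i : ℤ) < longSteps s d
  · have hiB' := hB.mp hiB
    rw [displacement, displacement, if_pos hiB.le, if_pos hiB'.le] at h3
    obtain ⟨h4, h5⟩ := abs_longMul_bounds hs hdn hii (by rw [abs_lt]; omega)
    -- Here `K` is the multiplier times the shift of the sources, reduced by `n` for each of the `i'
    -- - i` long steps.
    refine sourceColour_ne hs (K := ε * (((i' : ℤ) - i) * (s * multiplier n s - n))) ?_
      (by rwa [abs_mul, hεabs, one_mul]) (by rwa [abs_mul, hεabs, one_mul]) hc
    have : multiplier n s * (x - x') - ε * (((i' : ℤ) - i) * (s * multiplier n s - n)) =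
        (x + ε * (i * s) - (x' + ε * (i' * s))) * multiplier n s + n * (ε * ((i' : ℤ) - i)) := by
      ring
    rw [this]
    exact dvd_add (h3.mul_right _) (dvd_mul_right _ _)
  · have hiB' := fun h => hiB (hB.mpr h)
    have hdisp : ∀ j : ℕ, ¬ (j : ℤ) < longSteps s d →
        displacement s d j = longSteps s d * s + shortSign s d * (j - longSteps s d) := by
      intro j hj
      unfold displacement
      split_ifs with h
      · rw [show (j : ℤ) = longSteps s d by omega]; ring
      · rfl
    rw [hdisp i hiB, hdisp i' hiB'] at h3
    obtain ⟨h4, h5⟩ := abs_shortMul_bounds hs hn hw (d := d) hii (by rw [abs_lt]; omega)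
    have hσabs : |shortSign s d| = 1 := by
      rcases shortSign_eq s d with h | h <;> rw [h] <;> simp
    refine sourceColour_ne hs (K := ε * (shortSign s d * (((i' : ℤ) - i) * multiplier n s))) ?_
      (by rwa [abs_mul, hεabs, one_mul, abs_mul, hσabs, one_mul])
      (by rwa [abs_mul, hεabs, one_mul, abs_mul, hσabs, one_mul]) hc
    have : multiplier n s * (x - x') - ε * (shortSign s d * (((i' : ℤ) - i) * multiplier n s)) =
        (x + ε * (longSteps s d * s + shortSign s d * (i - longSteps s d)) -
          (x' + ε * (longSteps s d * s + shortSign s d * (i' - longSteps s d)))) *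
          multiplier n s := by
      ring
    rw [this]
    exact h3.mul_right _

/-- Otherwise `sign_mul_stepAt_eq`, applied to a direction and its negative, would make them equal.
-/
theorem not_opposite_arcs (hs : 3 ≤ s) (hn : 4 * s + 2 ≤ n) {i i' : ℕ}
    (h1 : pathNode n s x e i = pathNode n s x' e (i' + 1))
    (h2 : pathNode n s x e (i + 1) = pathNode n s x' e i') : False := by
  have h3 : ((cycSign n e * stepAt s (cycDist n e) i : ℤ) : ZMod n) =
      ((-cycSign n e * stepAt s (cycDist n e) i' : ℤ) : ZMod n) := by
    rw [pathNode_succ, h1, pathNode_succ] at h2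
    rw [neg_mul, Int.cast_neg, eq_neg_iff_add_eq_zero]
    have h4 := sub_eq_zero.mpr h2
    rw [← h4]
    ring
  have := (sign_mul_stepAt_eq hs hn (cycSign_eq n e)
    (by rcases cycSign_eq n e with h | h <;> simp [h]) h3).1
  rcases cycSign_eq n e with h | h <;> rw [h] at this <;> omega

end Conflicts

/-! ### Conflict-freeness and the number of colours -/

section Colouring

variable {n : ℕ} [NeZero n]

theorem sourceColour_mem {s : ℤ} (hs : 3 ≤ s) (x : ℤ) :
    0 ≤ sourceColour n s x ∧ sourceColour n s x ≤ n / width s ∧ sourceColour n s x < n := by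
  have hn : (0 : ℤ) < n := by exact_mod_cast NeZero.pos n
  obtain ⟨hw, -⟩ := width_bounds hs
  have h0 := Int.emod_nonneg (multiplier n s * x) hn.ne'
  have h1 := Int.emod_lt_of_pos (multiplier n s * x) hn
  exact ⟨Int.ediv_nonneg h0 hw.le, Int.ediv_le_ediv hw h1.le,
    (Int.ediv_le_self _ h0).trans_lt h1⟩

/-- Source colours lie in [0, n), so division by `n` recovers the tag. -/
theorem reqColour_eq_iff {s : ℤ} (hs : 3 ≤ s) {c : Bool} {p p' : Request (ZMod n)}
    (h : reqColour c s p = reqColour c s p') :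
    sourceColour n s p.1.1.val = sourceColour n s p'.1.1.val ∧
      diffTag c n (reqDiff p) = diffTag c n (reqDiff p') := by
  have hn : (0 : ℤ) < n := by exact_mod_cast NeZero.pos n
  obtain ⟨h1, -, h2⟩ := sourceColour_mem (n := n) hs p.1.1.val
  obtain ⟨h3, -, h4⟩ := sourceColour_mem (n := n) hs p'.1.1.val
  unfold reqColour at h
  have h5 : diffTag c n (reqDiff p) = diffTag c n (reqDiff p') := by
    have h6 := congrArg (· / (n : ℤ)) h
    simp only [Int.add_mul_ediv_left _ _ hn.ne', Int.ediv_eq_zero_of_lt h1 h2,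
      Int.ediv_eq_zero_of_lt h3 h4] at h6
    omega
  exact ⟨by rw [h5] at h; omega, h5⟩

theorem request_ext {p p' : Request (ZMod n)}
    (hx : ((p.1.1.val : ℤ) : ZMod n) = ((p'.1.1.val : ℤ) : ZMod n))
    (hd : reqDiff p = reqDiff p') : p = p' := by
  have h1 : p.1.1 = p'.1.1 := by simpa using hx
  have h2 := congrArg (Int.cast : ℤ → ZMod n) hd
  rw [intCast_reqDiff, intCast_reqDiff, h1] at h2
  exact Subtype.ext (Prod.ext h1 (sub_left_injective h2))

variable {s : ℕ} {R : Routing (circ n s)}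

theorem reqColour_edgeConflictFree (hs : 3 ≤ s) (hn : 4 * s + 2 ≤ n)
    (hw : ((s : ℤ) - 1) * width s ≤ n)
    (hR : ∀ p : Request (ZMod n), ∀ a ∈ (R p).1.darts,
      ∃ i < stepCount s (cycDist n (reqDiff p)), a.fst = pathNode n s p.1.1.val (reqDiff p) i ∧
        a.snd = pathNode n s p.1.1.val (reqDiff p) (i + 1)) :
    EdgeConflictFree R (reqColour true s) := by
  have hs' : (3 : ℤ) ≤ s := by exact_mod_cast hs
  have hn' : 4 * (s : ℤ) + 2 ≤ n := by exact_mod_cast hn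
  rintro p p' hne ⟨e, he, he'⟩ hc
  obtain ⟨hsc, htag⟩ := reqColour_eq_iff hs' hc
  have hd : reqDiff p = reqDiff p' := by simpa [diffTag] using htag
  obtain ⟨a, ha, rfl⟩ := List.mem_map.mp he
  obtain ⟨a', ha', haa⟩ := List.mem_map.mp he'
  obtain ⟨i, hi, h1, h2⟩ := hR p a ha
  obtain ⟨i', hi', h1', h2'⟩ := hR p' a' ha'
  rw [← hd] at h1' h2' hi'
  rcases SimpleGraph.dart_edge_eq_iff _ _ |>.mp haa with rfl | rfl
  · exact hne (request_ext (eq_of_common_arc hs' hn' hw rfl hi hi' (h1.symm.trans h1')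
      (h2.symm.trans h2') hsc).2 hd)
  · exact not_opposite_arcs hs' hn' (h1.symm.trans h2') (h2.symm.trans h1')

/-- A common arc already forces equal directions, and direction and length determine the difference.
So the length suffices as a tag, which halves the number of tags. -/
theorem reqColour_arcConflictFree (hs : 3 ≤ s) (hn : 4 * s + 2 ≤ n)
    (hw : ((s : ℤ) - 1) * width s ≤ n)
    (hR : ∀ p : Request (ZMod n), ∀ a ∈ (R p).1.darts,
      ∃ i < stepCount s (cycDist n (reqDiff p)), a.fst = pathNode n s p.1.1.val (reqDiff p) i ∧
        a.snd = pathNode n s p.1.1.val (reqDiff p) (i + 1)) :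
    ArcConflictFree R (reqColour false s) := by
  have hs' : (3 : ℤ) ≤ s := by exact_mod_cast hs
  have hn' : 4 * (s : ℤ) + 2 ≤ n := by exact_mod_cast hn
  rintro p p' hne ⟨a, ha, ha'⟩ hc
  obtain ⟨hsc, htag⟩ := reqColour_eq_iff hs' hc
  have hd : cycDist n (reqDiff p) = cycDist n (reqDiff p') := by simpa [diffTag] using htag
  obtain ⟨i, hi, h1, h2⟩ := hR p a ha
  obtain ⟨i', hi', h1', h2'⟩ := hR p' a ha'
  obtain ⟨hε, hx⟩ := eq_of_common_arc hs' hn' hw hd hi hi' (h1.symm.trans h1')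
    (h2.symm.trans h2') hsc
  refine hne (request_ext hx ?_)
  unfold cycDist at hd
  unfold cycSign at hε
  split_ifs at hd hε <;> omega

theorem ncard_range_reqColour_le (c : Bool) (hs : 3 ≤ s) {T : ℕ}
    (hT : ∀ p : Request (ZMod n), diffTag c n (reqDiff p) < T) :
    ((Set.range (reqColour c s : Request (ZMod n) → ℤ)).ncard : ℤ) ≤ (n / width s + 1) * T := by
  have hs' : (3 : ℤ) ≤ s := by exact_mod_cast hs
  have hw := (width_bounds hs').1
  have hsub : Set.range (reqColour c s : Request (ZMod n) → ℤ) ⊆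
      ((Finset.Icc (0 : ℤ) (n / width s) ×ˢ Finset.Ico (0 : ℤ) T).image
        fun q => q.1 + n * q.2 : Finset ℤ) := by
    rintro _ ⟨p, rfl⟩
    obtain ⟨h1, h2, -⟩ := sourceColour_mem (n := n) hs' p.1.1.val
    have h3 : 0 ≤ diffTag c n (reqDiff p) := by
      unfold diffTag
      split_ifs
      · exact reqDiff_nonneg p
      · exact cycDist_nonneg (reqDiff_nonneg p) (reqDiff_lt p)
    simp only [Finset.coe_image, Set.mem_image, Finset.mem_coe, Finset.mem_product,
      Finset.mem_Icc, Finset.mem_Ico]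
    exact ⟨(_, _), ⟨⟨h1, h2⟩, h3, hT p⟩, rfl⟩
  have h := (Set.ncard_le_ncard hsub (Finset.finite_toSet _)).trans
    ((Set.ncard_coe_finset _).le.trans Finset.card_image_le)
  rw [Finset.card_product, Int.card_Icc, Int.card_Ico] at h
  have h0 : (0 : ℤ) ≤ n / width s := Int.ediv_nonneg (by positivity) hw.le
  zify at h
  rw [Int.toNat_of_nonneg (by omega), Int.toNat_of_nonneg (by omega)] at h
  simpa using h

end Colouring

/-! ## The output of the program -/

theorem encodeRequest_eq {c : Bool} {n s : ℕ} [NeZero n] {R : Routing (circ n s)}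
    {p : Request (ZMod n)} (hs : 3 ≤ s) (hn : 2 * s ≤ n)
    (hR : (R p).1.support = (List.range (stepCount s (cycDist n (reqDiff p)) + 1)).map
      (pathNode n s p.1.1.val (reqDiff p))) :
    encodeRequest R (reqColour c s) p =
      recordOut c n s p.1.1.val ((multiplier n s * p.1.1.val) % n) (reqDiff p) := by
  have hs' : (3 : ℤ) ≤ s := by exact_mod_cast hs
  have hn' : 2 * (s : ℤ) ≤ n := by exact_mod_cast hn
  obtain ⟨hB, -, hA, -⟩ := stepBounds n s hs' hn' (reqDiff_nonneg p) (reqDiff_lt p)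
  unfold encodeRequest recordOut
  rw [hR]
  have hx : (p.1.1.val : ℤ) % n = p.1.1.val :=
    Int.emod_eq_of_lt (by positivity) (by exact_mod_cast ZMod.val_lt _)
  have hcount : stepCount s (cycDist n (reqDiff p)) =
      (longSteps s (cycDist n (reqDiff p))).toNat + (shortSteps s (cycDist n (reqDiff p))).toNat :=
    Int.toNat_add hB hA
  have hnode : ∀ i, (((pathNode n s p.1.1.val (reqDiff p) i).val : ℕ) : ℤ) =
      (p.1.1.val + cycSign n (reqDiff p) * displacement s (cycDist n (reqDiff p)) i) % n :=
    fun i => ZMod.val_intCast _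
  have hcol : reqColour c s p = (multiplier n s * p.1.1.val) % n / width s +
      n * diffTag c n (reqDiff p) := rfl
  simp only [List.length_map, List.length_range, List.map_map, Function.comp_def, hnode, hcol]
  generalize (p.1.1.val : ℤ) = x at *
  generalize reqDiff p = e at *
  -- The node list is split as the program emits it: the source, the long steps, the short steps.
  rw [hcount, List.range_succ_eq_map, List.range_add]
  simp only [List.map_cons, List.map_append, List.map_map, List.cons_append, Function.comp_def]
  refine congrArg₂ _ ?_ (congrArg₂ _ ?_ (congrArg₂ _ (congrArg₂ _ ?_ ?_) rfl))
  · push_cast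
    rw [Int.toNat_of_nonneg hB, Int.toNat_of_nonneg hA]
  · simp [displacement, hB, hx]
  · refine List.map_congr_left fun i hi => ?_
    have := List.mem_range.mp hi
    rw [displacement, if_pos (by push_cast; omega)]
    congr 1
    push_cast
    ring
  · refine List.map_congr_left fun i hi => ?_
    rw [displacement, if_neg (by push_cast; omega)]
    congr 1
    push_cast
    rw [Int.toNat_of_nonneg hB]
    ring

theorem encodeRouting_eq {c : Bool} {n s : ℕ} [NeZero n] {R : Routing (circ n s)}
    (hs : 3 ≤ s) (hn : 2 * s ≤ n)
    (hR : ∀ p : Request (ZMod n), (R p).1.support =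
      (List.range (stepCount s (cycDist n (reqDiff p)) + 1)).map
        (pathNode n s p.1.1.val (reqDiff p))) :
    encodeRouting R (reqColour c s) = (List.range n).flatMap fun x : ℕ =>
      (List.range n).flatMap fun y : ℕ => if 0 < ((y : ℤ) - x) % n then
        recordOut c n s x ((multiplier n s * x) % n) (((y : ℤ) - x) % n) else [] := by
  unfold encodeRouting
  simp only [bind_pure_comp, List.map_eq_map, List.flatMap_map]
  refine List.flatMap_congr fun x hx => List.flatMap_congr fun y hy => ?_
  have hx' : (x : ZMod n).val = x := ZMod.val_natCast_of_lt (List.mem_range.mp hx)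
  have hy' : (y : ZMod n).val = y := ZMod.val_natCast_of_lt (List.mem_range.mp hy)
  have h0 := Int.emod_nonneg ((y : ℤ) - x) (b := n) (by exact_mod_cast NeZero.ne n)
  have hiff : ((x : ZMod n) ≠ (y : ZMod n)) ↔ 0 < ((y : ℤ) - x) % n := by
    rw [lt_iff_le_and_ne, and_iff_right h0, ne_comm (a := (0 : ℤ)), not_iff_not.symm, not_not,
      not_not, ← Int.dvd_iff_emod_eq_zero, ← ZMod.intCast_eq_intCast_iff_dvd_sub]
    simp
  by_cases h : (x : ZMod n) ≠ (y : ZMod n)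
  · rw [dif_pos h, if_pos (hiff.mp h), encodeRequest_eq hs hn (hR _)]
    simp only [reqDiff, hx', hy']
  · rw [dif_neg h, if_neg (fun h' => h (hiff.mpr h'))]

/-! ## The approximation ratio -/

/-- The first bound is the squared hypothesis. If 1000(s+1) > n, it would give 8n < 9·10⁶, which the
size of `n` excludes. -/
theorem nat_bounds_of_range {n s : ℕ} (hn : 2000000 ≤ n)
    (h : (s : ℝ) ≤ 3 * Real.sqrt (n : ℝ) / (2 * Real.sqrt 2) - 1) :
    8 * (s + 1) ^ 2 ≤ 9 * n ∧ 1000 * (s + 1) ≤ n := by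
  have h1 : ((s : ℝ) + 1) * (2 * Real.sqrt 2) ≤ 3 * Real.sqrt n := by
    rw [← le_div_iff₀ (by positivity)]
    linarith
  have h2 : (((s : ℝ) + 1) * (2 * Real.sqrt 2)) ^ 2 ≤ (3 * Real.sqrt n) ^ 2 :=
    pow_le_pow_left₀ (by positivity) h1 2
  rw [mul_pow, mul_pow, mul_pow, Real.sq_sqrt (by norm_num), Real.sq_sqrt (by positivity)] at h2
  have h3 : 8 * (s + 1) ^ 2 ≤ 9 * n := by
    have : (8 * ((s : ℝ) + 1) ^ 2) ≤ 9 * n := by linarith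
    exact_mod_cast this
  refine ⟨h3, ?_⟩
  by_contra h4
  nlinarith

/-- Treats both problems at once: `b = 1` with `n` tags, and `b = 2` with `n / 2 + 1` tags. -/
theorem ratio_le {n s T K k : ℕ} (hn : 2000000 ≤ n) (hs : 3 ≤ s) (hs' : 1000 * (s + 1) ≤ n)
    {b : ℕ} (hb : 0 < b) (hT : b * T ≤ n + 2)
    (hK : (K : ℤ) ≤ (n / width s + 1) * T) (hk : n ^ 2 / 4 ≤ b * (s + 1) * k) :
    (K : ℝ) ≤ 4.85 * (k : ℝ) := by
  obtain ⟨hw0, -, hw, -⟩ := width_bounds (s := s) (by exact_mod_cast hs)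
  have h1 : (n : ℤ) / width s * width s ≤ n := Int.ediv_mul_le _ hw0.ne'
  have h2 : 0 ≤ (n : ℤ) / width s := Int.ediv_nonneg (by positivity) hw0.le
  generalize (n : ℤ) / width s = q at h1 h2 hK
  have h3 : 5 * ((s : ℤ) + 1) * q ≤ 6 * n := by nlinarith
  have h4 : 5 * ((s : ℤ) + 1) * (q + 1) ≤ 6 * n + 5 * (s + 1) := by linarith
  have h5 : 5 * ((s : ℤ) + 1) * (b * K) ≤ (6 * n + 5 * (s + 1)) * (n + 2) := by
    calc 5 * ((s : ℤ) + 1) * (b * K) ≤ 5 * ((s : ℤ) + 1) * (b * ((q + 1) * T)) := by gcongr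
      _ = (5 * ((s : ℤ) + 1) * (q + 1)) * (b * T) := by ring
      _ ≤ (6 * n + 5 * (s + 1)) * (n + 2) := by
        gcongr
        exact_mod_cast hT
  have h6 : (n : ℤ) ^ 2 ≤ 4 * (b * (s + 1) * k) + 3 := by
    have : n ^ 2 ≤ 4 * (b * (s + 1) * k) + 3 := by omega
    exact_mod_cast this
  have hsn : 1000 * ((s : ℤ) + 1) ≤ n := by exact_mod_cast hs'
  have hnn : (2000000 : ℤ) ≤ n := by exact_mod_cast hn
  have h7 : 1000 * ((6 * (n : ℤ) + 5 * (s + 1)) * (n + 2)) ≤ 6005 * (n * (n + 2)) := by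
    have : (6000 * (n : ℤ) + 5 * (1000 * (s + 1))) * (n + 2) ≤ (6000 * n + 5 * n) * (n + 2) := by
      gcongr
    linarith
  -- Here 24250 = 5000 · 4.85, against 4 · 6005 = 24020; the gap absorbs the linear terms and the
  -- rounding in `n ^ 2 / 4`.
  have h8 : 4 * (6005 * ((n : ℤ) * (n + 2))) ≤ 24250 * ((n : ℤ) ^ 2 - 3) := by nlinarith
  have h9 : ((b : ℤ) * (s + 1)) * (20000 * K) ≤ ((b : ℤ) * (s + 1)) * (97000 * k) := by
    linarith
  have h10 : (20000 * K : ℤ) ≤ 97000 * k :=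
    le_of_mul_le_mul_left h9 (by positivity)
  have h11 : (20000 * K : ℝ) ≤ 97000 * k := by exact_mod_cast h10
  linarith

/-- From 6w ≤ 5(s+2) and (s-1)(s+2) ≤ (s+1)² follows (s-1)w ≤ 5(s+1)²/6 ≤ 15n/16. -/
theorem width_mul_le {n s : ℕ} (hs : 3 ≤ s) (h : 8 * (s + 1) ^ 2 ≤ 9 * n) :
    ((s : ℤ) - 1) * width s ≤ n := by
  obtain ⟨-, -, -, hw⟩ := width_bounds (s := s) (by exact_mod_cast hs)
  have h' : 8 * ((s : ℤ) + 1) ^ 2 ≤ 9 * n := by exact_mod_cast h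
  have hs' : (3 : ℤ) ≤ s := by exact_mod_cast hs
  nlinarith

/-- For each of the two problems there is a program whose running time is polynomial in `n` and
which, for all large `n` and all `s` in the stated range, outputs an all-to-all routing of
`C_n(1, s)` with a conflict-free colouring that uses at most `4.85` times the optimal number of
colours. -/
theorem mainTheorem5 :
    (∃ (P : Prog) (N C k : ℕ), ∀ n : ℕ, N ≤ n → ∀ s : ℕ, 3 ≤ s →
      (s : ℝ) ≤ 3 * Real.sqrt (n : ℝ) / (2 * Real.sqrt 2) - 1 →
        (P.exec n s).steps ≤ C * n ^ k ∧
        ∃ (R : Routing (circ n s)) (f : Request (ZMod n) → ℤ),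
          (P.exec n s).out = encodeRouting R f ∧
          EdgeConflictFree R f ∧
          ((Set.range f).ncard : ℝ) ≤ 4.85 * (opticalIndex (circ n s) : ℝ)) ∧
    (∃ (P : Prog) (N C k : ℕ), ∀ n : ℕ, N ≤ n → ∀ s : ℕ, 3 ≤ s →
      (s : ℝ) ≤ 3 * Real.sqrt (n : ℝ) / (2 * Real.sqrt 2) - 1 →
        (P.exec n s).steps ≤ C * n ^ k ∧
        ∃ (R : Routing (circ n s)) (f : Request (ZMod n) → ℤ),
          (P.exec n s).out = encodeRouting R f ∧
          ArcConflictFree R f ∧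
          ((Set.range f).ncard : ℝ) ≤ 4.85 * (directedOpticalIndex (circ n s) : ℝ)) := by
  constructor
  · refine ⟨routingProg true, 2000000, 2000, 3, fun n hn s hs hsn => ?_⟩
    obtain ⟨h1, h2⟩ := nat_bounds_of_range hn hsn
    have : NeZero n := ⟨by omega⟩
    have h3 : 2 * s ≤ n := by omega
    obtain ⟨hout, hsteps⟩ := routingProg_exec true n s (by omega) fun e he hen =>
      stepBounds n s (by exact_mod_cast hs) (by exact_mod_cast h3) he hen
    obtain ⟨R, hR⟩ := exists_routing (n := n) s hs h3
    refine ⟨hsteps, R, reqColour true s, ?_, ?_, ?_⟩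
    · rw [hout, encodeRouting_eq hs h3 fun p => (hR p).1]
      rfl
    · exact reqColour_edgeConflictFree hs (by omega) (width_mul_le hs h1) fun p => (hR p).2
    · refine ratio_le hn hs h2 one_pos (T := n) (by omega)
        (ncard_range_reqColour_le true hs fun p => reqDiff_lt p) ?_
      rw [one_mul]
      exact le_opticalIndex R
  · refine ⟨routingProg false, 2000000, 2000, 3, fun n hn s hs hsn => ?_⟩
    obtain ⟨h1, h2⟩ := nat_bounds_of_range hn hsn
    have : NeZero n := ⟨by omega⟩
    have h3 : 2 * s ≤ n := by omega
    obtain ⟨hout, hsteps⟩ := routingProg_exec false n s (by omega) fun e he hen =>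
      stepBounds n s (by exact_mod_cast hs) (by exact_mod_cast h3) he hen
    obtain ⟨R, hR⟩ := exists_routing (n := n) s hs h3
    refine ⟨hsteps, R, reqColour false s, ?_, ?_, ?_⟩
    · rw [hout, encodeRouting_eq hs h3 fun p => (hR p).1]
      rfl
    · exact reqColour_arcConflictFree hs (by omega) (width_mul_le hs h1) fun p => (hR p).2
    · refine ratio_le hn hs h2 two_pos (T := n / 2 + 1) (by omega)
        (ncard_range_reqColour_le false hs fun p => ?_) (le_directedOpticalIndex R)
      have : diffTag false n (reqDiff p) = cycDist n (reqDiff p) := rfl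
      have := two_mul_cycDist_le (n := n) (e := reqDiff p)
      omega
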